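/- Let $\pi : X \to Y$ be a morphism locally of finite type of locally Noetherian schemes, and let $x \in X$. We use the following terminology. - $\pi$ is *smooth at* $\xi\in X$ if its restriction to some open neighbourhood of $\xi$ is smooth. A point $\xi \in X$ is *associated* if the maximal ideal of $\mathcal{O}_{X,\xi}$ is an associated prime of $\mathcal{O}_{X,\xi}$, and *maximal* if $\dim \mathcal{O}_{X,\xi} = 0$. The morphism $\pi$ is *generically smooth* if it is smooth at every maximal point of $X$. - $\pi$ is *l.c.i. at* $x$ (locally complete intersection) if there are an open neighbourhood $U$ of $x$ and a factorisation $U \xrightarrow{i} Z \xrightarrow{p} Y$ of $\pi|_U$ with $p$ smooth and $i$ a regular closed immersion, i.e. a closed immersion whose ideal is generated by a regular sequence of sections near each point of $i(U)$. - $\pi$ is *d.c.i. at* $x$ (differential complete intersection) if $\operatorname{pd}_{\mathcal{O}_{X,x}} \Omega_{X/Y,x} \le 1$, where $\operatorname{pd}$ denotes projective dimension and $\Omega_{X/Y,x} = \Omega_{\mathcal{O}_{X,x}/\mathcal{O}_{Y,\pi(x)}}$. Then: 1. If $\pi$ is smooth at all associated points of $X$ and $\pi$ is l.c.i. at $x$,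 then $\pi$ is d.c.i. at $x$. 2. If $\pi$ is generically smooth, $\operatorname{pd}_{\mathcal{O}_{Y,\pi(x)}} \mathcal{O}_{X,x} < \infty$, and $\pi$ is d.c.i. at $x$, then $\pi$ is l.c.i. at $x$. -/

import Mathlib

open CategoryTheory AlgebraicGeometry

universe u

namespace DiffCI

variable {X Y : Scheme.{u}}

/-- `ξ` is an associated point of the (locally Noetherian) scheme `X`: the maximal ideal of the
local ring of `X` at `ξ` is an associated prime of that ring. -/
def IsAssociatedPoint (ξ : X) : Prop :=
  IsLocalRing.maximalIdeal (X.presheaf.stalk ξ) ∈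
    associatedPrimes (X.presheaf.stalk ξ) (X.presheaf.stalk ξ)

/-- `ξ` is a maximal point of `X`: a point of height `0`, i.e. the local ring of `X` at `ξ` has
Krull dimension `0`. -/
def IsMaximalPoint (ξ : X) : Prop :=
  ringKrullDim (X.presheaf.stalk ξ) = 0

/-- `f` is smooth at `x`: the restriction of `f` to some open neighbourhood of `x` is smooth. -/
def IsSmoothAt (f : X ⟶ Y) (x : X) : Prop :=
  ∃ U : X.Opens, x ∈ U ∧ Smooth (U.ι ≫ f)

/-- `f` is generically smooth: it is smooth at every maximal point of `X`. -/
def IsGenericallySmooth (f : X ⟶ Y) : Prop :=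
  ∀ ξ : X, IsMaximalPoint ξ → IsSmoothAt f ξ

/-- A regular closed immersion: a closed immersion whose ideal is, in a neighbourhood of each
point of its image, generated by a regular sequence of sections. -/
structure IsRegularImmersion (i : X ⟶ Y) : Prop where
  isClosedImmersion : IsClosedImmersion i
  exists_isRegular : ∀ x : X, ∃ W : Y.affineOpens, i x ∈ (W : Y.Opens) ∧
    ∃ rs : List Γ(Y, W), RingTheory.Sequence.IsRegular Γ(Y, W) rs ∧
      RingHom.ker (i.app W).hom = Ideal.ofList rs

/-- `f` is a locally complete intersection at `x`: on an open neighbourhood of `x` it factors as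
a regular closed immersion into a scheme that is smooth over `Y`. -/
def IsLCIAt (f : X ⟶ Y) (x : X) : Prop :=
  ∃ U : X.Opens, x ∈ U ∧ ∃ (Z : Scheme.{u}) (i : U.toScheme ⟶ Z) (p : Z ⟶ Y),
    IsRegularImmersion i ∧ Smooth p ∧ i ≫ p = U.ι ≫ f

/-- The module of relative differentials of `X / Y` at `x`, i.e. the module of Kähler
differentials of the local homomorphism `𝒪_{Y, f x} ⟶ 𝒪_{X, x}`. -/
noncomputable def stalkDifferentials (f : X ⟶ Y) (x : X) : ModuleCat (X.presheaf.stalk x) :=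
  CommRingCat.KaehlerDifferential (f.stalkMap x)

/-- `f` is a differential complete intersection at `x`: the module of relative differentials at
`x` has projective dimension at most `1` over the local ring at `x`. -/
def IsDCIAt (f : X ⟶ Y) (x : X) : Prop :=
  projectiveDimension (stalkDifferentials f x) ≤ 1

/-- The local ring `𝒪_{X, x}` regarded as a module over `𝒪_{Y, f x}`. -/
noncomputable def stalkModule (f : X ⟶ Y) (x : X) : ModuleCat (Y.presheaf.stalk (f x)) :=
  (ModuleCat.restrictScalars (f.stalkMap x).hom).obj
    (ModuleCat.of (X.presheaf.stalk x) (X.presheaf.stalk x))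

end DiffCI

/-! Locally at `x`, write `B = 𝒪_{X,x}` as `A / I`, with `A` a local ring of a scheme smooth over
`Y`, and let `R = 𝒪_{Y,π(x)}`. Everything rests on the conormal sequence `I/I² → B ⊗ Ω[A/R] → Ω[B/R]
→ 0`, whose middle term is projective and whose first map is injective at every prime where `B` is
formally smooth over `R`.

If `I` is generated by a regular sequence, `I/I²` is free over `B`. The kernel of the first map
vanishes at the associated primes of `B`, so it is zero as a submodule of a free module. The
sequence is then a projective resolution of length one
(`hasProjectiveDimensionLE_one_kaehlerDifferential`).

Conversely, if `Ω[B/R]` has projective dimension at most one, the kernel of `B ⊗ Ω[A/R] → Ω[B/R]` is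
free of some rank `r`. It is a quotient of `I`, and the kernel of `I → B^r` agrees with `I²` at the
minimal primes. Finite projective dimension of `B` passes from `R` to a polynomial ring and to its
localization `A`. Vasconcelos' argument (`exists_isWeaklyRegular_ker_eq_ofList`) now shows by
induction on `r` that `I` is generated by a regular sequence: a regular `f ∈ I` with invertible
first coordinate makes `B` a retract of `I/fI` over `A/f`, so the hypotheses descend to `A/f`. For
`r = 0`, Nakayama kills `I` at a prime, while a nonzero `I` would contain a regular element
(`exists_mem_ker_nonZeroDivisors`). Finally the regular sequence spreads out from the local ring to
a neighbourhood. -/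

/-! ### Projective dimension via kernels, and reduction modulo a regular element. -/

open Module in
lemma hasProjectiveDimensionLE_zero_iff_projective {A M : Type u} [CommRing A] [AddCommGroup M]
    [Module A M] : HasProjectiveDimensionLE (ModuleCat.of A M) 0 ↔ Module.Projective A M := by
  rw [← projective_iff_hasProjectiveDimensionLE_zero, ← IsProjective.iff_projective]

lemma hasProjectiveDimensionLE_succ_iff_ker {A M F : Type u} [CommRing A] [AddCommGroup M]
    [Module A M] [AddCommGroup F] [Module A F] [Module.Projective A F] {p : F →ₗ[A] M}
    (hp : Function.Surjective p) (n : ℕ) :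
    HasProjectiveDimensionLE (ModuleCat.of A M) (n + 1) ↔
      HasProjectiveDimensionLE (ModuleCat.of A (LinearMap.ker p)) n := by
  have h := LinearMap.shortExact_shortComplexKer hp
  have : Projective p.shortComplexKer.X₂ := by
    rw [← IsProjective.iff_projective]; assumption
  exact h.hasProjectiveDimensionLT_X₃_iff n this

lemma hasProjectiveDimensionLE_ker {A M F : Type u} [CommRing A] [AddCommGroup M]
    [Module A M] [AddCommGroup F] [Module A F] [Module.Projective A F] {p : F →ₗ[A] M}
    (hp : Function.Surjective p) (n : ℕ) (h : HasProjectiveDimensionLE (ModuleCat.of A M) n) :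
    HasProjectiveDimensionLE (ModuleCat.of A (LinearMap.ker p)) n :=
  (hasProjectiveDimensionLE_succ_iff_ker hp n).mp
    (hasProjectiveDimensionLT_of_ge _ (n + 1) (n + 1 + 1) (by omega))

/-- Descent device for quotients: `t` factors through `N` because it kills `ker h`, and
`A'`-linearity is automatic because `A → A'` is onto. -/
lemma LinearMap.exists_extendScalars_factor {A A' M N L : Type*} [CommRing A] [CommRing A']
    [Algebra A A'] (hs : Function.Surjective (algebraMap A A')) [AddCommGroup M] [Module A M]
    [AddCommGroup N] [Module A N] [Module A' N] [IsScalarTower A A' N] [AddCommGroup L]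
    [Module A L] [Module A' L] [IsScalarTower A A' L] {h : M →ₗ[A] N}
    (hsurj : Function.Surjective h) (t : M →ₗ[A] L) (ht : ∀ x, h x = 0 → t x = 0) :
    ∃ t' : N →ₗ[A'] L, ∀ x, t' (h x) = t x := by
  let t₁ : N →ₗ[A] L := (h.ker.liftQ t (fun x hx ↦ ht x hx)) ∘ₗ
    (LinearMap.quotKerEquivOfSurjective h hsurj).symm.toLinearMap
  refine ⟨t₁.extendScalarsOfSurjective hs, fun x ↦ ?_⟩
  have : (LinearMap.quotKerEquivOfSurjective h hsurj).symm (h x) = Submodule.Quotient.mk x := by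
    rw [LinearEquiv.symm_apply_eq]; rfl
  change t₁ (h x) = t x
  simp only [t₁, LinearMap.comp_apply, LinearEquiv.coe_coe, this]
  rfl

/-- If `f` is regular on `A` and on `M`, projective dimension does not increase when passing from
`M` to `M / f M`, seen as a module over `A / f`. -/
lemma hasProjectiveDimensionLE_of_ker_eq_range_smul {A A' : Type u} [CommRing A] [CommRing A']
    [Algebra A A'] (hs : Function.Surjective (algebraMap A A')) {f : A}
    (hf : ∀ a : A, f * a = 0 → a = 0)
    (hker : ∀ a : A, algebraMap A A' a = 0 ↔ ∃ b, a = f * b) (n : ℕ) :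
    ∀ (M N : Type u) [AddCommGroup M] [Module A M] [AddCommGroup N] [Module A N] [Module A' N]
      [IsScalarTower A A' N] (h : M →ₗ[A] N) (_ : Function.Surjective h)
      (_ : ∀ x, h x = 0 ↔ ∃ y, x = f • y) (_ : ∀ x : M, f • x = 0 → x = 0)
      (_ : HasProjectiveDimensionLE (ModuleCat.of A M) n),
      HasProjectiveDimensionLE (ModuleCat.of A' N) n := by
  induction n with
  | zero =>
    intro M N _ _ _ _ _ _ h hsurj hh hM hpd
    rw [hasProjectiveDimensionLE_zero_iff_projective] at hpd ⊢
    obtain ⟨s, hs'⟩ := Module.projective_def'.mp hpd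
    let q : (M →₀ A') →ₗ[A'] N := Finsupp.linearCombination A' h
    let r : (M →₀ A) →ₗ[A] (M →₀ A') := Finsupp.mapRange.linearMap (Algebra.linearMap A A')
    -- The section of the free cover, reduced modulo `f`; it kills `f M`, so it descends to a
    -- section of `q`.
    let t0 : M →ₗ[A] (M →₀ A') := r ∘ₗ s
    have hqr : ∀ v, q (r v) = h (Finsupp.linearCombination A id v) := by
      intro v
      induction v using Finsupp.induction_linear with
      | zero => simp
      | add v w hv hw => simp only [map_add, hv, hw]
      | single m a => simp [q, r]
    have ht0 : ∀ x, h x = 0 → t0 x = 0 := by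
      intro x hx
      obtain ⟨y, rfl⟩ := (hh x).mp hx
      rw [map_smul]
      have : algebraMap A A' f = 0 := (hker f).mpr ⟨1, by simp⟩
      rw [← algebraMap_smul A' f (t0 y), this, zero_smul]
    obtain ⟨t', htapp⟩ := LinearMap.exists_extendScalars_factor hs hsurj t0 ht0
    refine Module.Projective.of_split t' q ?_
    ext x
    obtain ⟨x, rfl⟩ := hsurj x
    change q (t' (h x)) = h x
    rw [htapp]
    change q (r (s x)) = _
    rw [hqr]
    exact congrArg h (LinearMap.congr_fun hs' x)
  | succ n ih =>
    intro M N _ _ _ _ _ _ h hsurj hh hM hpd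
    let p : (M →₀ A) →ₗ[A] M := Finsupp.linearCombination A id
    let r : (M →₀ A) →ₗ[A] (M →₀ A') := Finsupp.mapRange.linearMap (Algebra.linearMap A A')
    let q : (M →₀ A') →ₗ[A'] N := Finsupp.linearCombination A' h
    have hp : Function.Surjective p := Finsupp.linearCombination_id_surjective A M
    have hqr : ∀ v, q (r v) = h (p v) := by
      intro v
      induction v using Finsupp.induction_linear with
      | zero => simp
      | add v w hv hw => simp only [map_add, hv, hw]
      | single m a => simp [q, r, p]
    have hq : Function.Surjective q := by
      intro y
      obtain ⟨x, rfl⟩ := hsurj y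
      obtain ⟨v, rfl⟩ := hp x
      exact ⟨r v, hqr v⟩
    have hr : Function.Surjective r := Finsupp.mapRange_surjective _ (map_zero _) hs
    have hr0 : ∀ v, r v = 0 ↔ ∃ w, v = f • w := by
      intro v
      constructor
      · intro hv
        classical
        have : ∀ m, ∃ b, v m = f * b := fun m ↦ (hker _).mp (by simpa [r] using DFunLike.congr_fun hv m)
        choose b hb using this
        refine ⟨Finsupp.onFinset v.support (fun m ↦ if v m = 0 then 0 else b m) ?_, ?_⟩
        · intro m hm
          simp only [ne_eq, ite_eq_left_iff, Classical.not_imp] at hm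
          simpa using hm.1
        · ext m
          by_cases hm : v m = 0
          · simp [hm]
          · simpa [hm] using hb m
      · rintro ⟨w, rfl⟩
        ext m
        have := (hker f).mpr ⟨1, by simp⟩
        simp [r, Algebra.smul_def, this]
    rw [hasProjectiveDimensionLE_succ_iff_ker hp] at hpd
    rw [hasProjectiveDimensionLE_succ_iff_ker hq]
    -- Both covers are free on the set `M`. As `f` is regular on `M`, reducing `ker p` modulo `f`
    -- gives exactly `ker q`, and `f` stays regular on `ker p`.
    let k : LinearMap.ker p →ₗ[A] LinearMap.ker q :=
      { toFun := fun v ↦ ⟨r v, by rw [LinearMap.mem_ker, hqr, v.2, map_zero]⟩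
        map_add' := fun v w ↦ by ext1; simp
        map_smul' := fun a v ↦ by ext1; simp }
    refine ih (LinearMap.ker p) (LinearMap.ker q) k ?_ ?_ ?_ hpd
    · rintro ⟨w, hw⟩
      obtain ⟨v, rfl⟩ := hr w
      rw [LinearMap.mem_ker, hqr, hh] at hw
      obtain ⟨y, hy⟩ := hw
      obtain ⟨y, rfl⟩ := hp y
      refine ⟨⟨v - f • y, by rw [LinearMap.mem_ker, map_sub, map_smul, hy, sub_self]⟩, ?_⟩
      ext1
      change r (v - f • y) = r v
      rw [map_sub, (hr0 _).mpr ⟨y, rfl⟩, sub_zero]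
    · rintro ⟨v, hv⟩
      rw [Subtype.ext_iff]
      change r v = 0 ↔ _
      rw [hr0]
      constructor
      · rintro ⟨w, rfl⟩
        exact ⟨⟨w, hM _ (by rw [← map_smul]; exact hv)⟩, rfl⟩
      · rintro ⟨⟨w, hw⟩, h⟩
        exact ⟨w, congrArg Subtype.val h⟩
    · rintro ⟨v, hv⟩ h
      ext m
      exact hf _ (by simpa using DFunLike.congr_fun (congrArg Subtype.val h) m)

/-! ### Projective dimension over polynomial rings and localizations. -/

section PolynomialDimension

open TensorProduct Polynomial

lemma Polynomial.exists_finsupp_sum_tmul_eq {R M : Type*} [CommRing R] [AddCommGroup M] [Module R M]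
    (w : R[X] ⊗[R] M) : ∃ v : ℕ →₀ M, w = v.sum fun n m ↦ (X ^ n : R[X]) ⊗ₜ[R] m := by
  classical
  induction w with
  | zero => exact ⟨0, by simp⟩
  | add x y hx hy =>
    obtain ⟨v, rfl⟩ := hx
    obtain ⟨v', rfl⟩ := hy
    exact ⟨v + v', by rw [Finsupp.sum_add_index] <;> simp [tmul_add]⟩
  | tmul p m =>
    induction p using Polynomial.induction_on' with
    | add p q hp hq =>
      obtain ⟨v, hv⟩ := hp
      obtain ⟨v', hv'⟩ := hq
      exact ⟨v + v', by rw [Finsupp.sum_add_index, add_tmul, hv, hv'] <;> simp [tmul_add]⟩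
    | monomial n a =>
      refine ⟨Finsupp.single n (a • m), ?_⟩
      rw [Finsupp.sum_single_index (by simp), tmul_smul, smul_tmul', ← C_mul_X_pow_eq_monomial,
        smul_eq_C_mul]

/-- The coefficients of an element of `R[X] ⊗ M`. -/
noncomputable def Polynomial.tensorCoeff (R M : Type*) [CommRing R] [AddCommGroup M] [Module R M]
    (n : ℕ) : R[X] ⊗[R] M →ₗ[R] M :=
  (TensorProduct.lid R M).toLinearMap ∘ₗ (Polynomial.lcoeff R n).rTensor M

lemma Polynomial.tensorCoeff_tmul {R M : Type*} [CommRing R] [AddCommGroup M] [Module R M]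
    (n : ℕ) (p : R[X]) (m : M) : tensorCoeff R M n (p ⊗ₜ m) = p.coeff n • m := by
  simp [tensorCoeff]

lemma Polynomial.tensorCoeff_sum {R M : Type*} [CommRing R] [AddCommGroup M] [Module R M]
    (n : ℕ) (v : ℕ →₀ M) :
    tensorCoeff R M n (v.sum fun n m ↦ (X ^ n : R[X]) ⊗ₜ[R] m) = v n := by
  classical
  rw [map_finsuppSum]
  simp [tensorCoeff_tmul, coeff_X_pow, Finsupp.sum]
  tauto

/-- The characteristic sequence `0 → R[X] ⊗ M → R[X] ⊗ M → M → 0`, with first map `δ = X ⊗ 1 - 1 ⊗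
X`, is a projective resolution over `R[X]`. -/
lemma Polynomial.hasProjectiveDimensionLE_one {R M : Type u} [CommRing R] [AddCommGroup M]
    [Module R M] [Module R[X] M] [IsScalarTower R R[X] M] [Module.Projective R M] :
    HasProjectiveDimensionLE (ModuleCat.of R[X] M) 1 := by
  let ξ : M →ₗ[R] M := (LinearMap.lsmul R[X] M X).restrictScalars R
  let ε : R[X] ⊗[R] M →ₗ[R[X]] M := LinearMap.liftBaseChange R[X] LinearMap.id
  let δ : R[X] ⊗[R] M →ₗ[R[X]] R[X] ⊗[R] M :=
    LinearMap.lsmul R[X] _ X - LinearMap.baseChange R[X] ξ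
  have hε (p : R[X]) (m : M) : ε (p ⊗ₜ m) = p • m := by simp [ε]
  have hδ (p : R[X]) (m : M) : δ (p ⊗ₜ m) = (X * p) ⊗ₜ m - p ⊗ₜ ((X : R[X]) • m) := by
    simp [δ, ξ, smul_tmul']
  have hsurj : Function.Surjective ε := fun m ↦ ⟨1 ⊗ₜ m, by simp [hε]⟩
  have hεδ (w) : ε (δ w) = 0 := by
    induction w with
    | zero => simp
    | add x y hx hy => simp [hx, hy]
    | tmul p m => rw [hδ, map_sub, hε, hε, smul_smul, mul_comm, sub_self]
  have hpow (n : ℕ) : ∀ m : M, ∃ y, (X ^ n : R[X]) ⊗ₜ[R] m = 1 ⊗ₜ ((X ^ n : R[X]) • m) + δ y := by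
    induction n with
    | zero => exact fun m ↦ ⟨0, by simp⟩
    | succ n ih =>
      intro m
      obtain ⟨y, hy⟩ := ih ((X : R[X]) • m)
      refine ⟨y + (X ^ n : R[X]) ⊗ₜ m, ?_⟩
      rw [map_add, hδ, pow_succ, mul_smul, ← add_assoc, ← hy, mul_comm]
      abel
  -- Modulo the image of `δ`, powers of `X` can be moved across the tensor sign; this gives
  -- exactness in the middle.
  have hrange (w) : ∃ y, w = 1 ⊗ₜ ε w + δ y := by
    obtain ⟨v, rfl⟩ := exists_finsupp_sum_tmul_eq w
    induction v using Finsupp.induction_linear with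
    | zero => exact ⟨0, by simp⟩
    | add v v' h h' =>
      obtain ⟨y, hy⟩ := h
      obtain ⟨y', hy'⟩ := h'
      refine ⟨y + y', ?_⟩
      rw [Finsupp.sum_add_index (by simp) (by simp [tmul_add]), map_add, map_add, tmul_add]
      nth_rw 1 [hy, hy']
      abel
    | single n m =>
      obtain ⟨y, hy⟩ := hpow n m
      exact ⟨y, by rw [Finsupp.sum_single_index (by simp), hε, hy]⟩
  have hcoeff (n : ℕ) (w) : tensorCoeff R M (n + 1) (δ w) =
      tensorCoeff R M n w - (X : R[X]) • tensorCoeff R M (n + 1) w := by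
    induction w with
    | zero => simp
    | add x y hx hy => simp only [map_add, hx, hy, smul_add]; abel
    | tmul p m =>
      rw [hδ, map_sub, tensorCoeff_tmul, tensorCoeff_tmul, tensorCoeff_tmul, tensorCoeff_tmul,
        coeff_X_mul, smul_comm]
  have hinj : Function.Injective δ := by
    rw [injective_iff_map_eq_zero]
    intro w hw
    obtain ⟨v, rfl⟩ := exists_finsupp_sum_tmul_eq w
    have h (n : ℕ) : v n = (X : R[X]) • v (n + 1) := by
      have := hcoeff n (v.sum fun n m ↦ (X ^ n : R[X]) ⊗ₜ[R] m)
      rwa [hw, map_zero, tensorCoeff_sum, tensorCoeff_sum, eq_comm, sub_eq_zero] at this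
    -- Each coefficient is a multiple of arbitrarily later ones, and those beyond the largest index
    -- of the support are zero.
    have h' (n k : ℕ) : v n = (X ^ k : R[X]) • v (n + k) := by
      induction k with
      | zero => simp
      | succ k ih => rw [ih, h (n + k), smul_smul, pow_succ, add_assoc]
    have : v = 0 := by
      ext n
      rw [h' n (v.support.sup id + 1), Finsupp.notMem_support_iff.mp, smul_zero, Finsupp.zero_apply]
      intro hn
      have := Finset.le_sup (f := id) hn
      simp only [id] at this
      omega
    simp [this]
  rw [show 1 = 0 + 1 from rfl, hasProjectiveDimensionLE_succ_iff_ker hsurj,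
    hasProjectiveDimensionLE_zero_iff_projective]
  let e : R[X] ⊗[R] M ≃ₗ[R[X]] LinearMap.ker ε :=
    LinearEquiv.ofBijective (δ.codRestrict _ hεδ)
      ⟨fun x y h ↦ hinj (congrArg Subtype.val h), fun ⟨w, hw⟩ ↦ by
        obtain ⟨y, hy⟩ := hrange w
        refine ⟨y, Subtype.ext ?_⟩
        rw [LinearMap.mem_ker.mp hw, tmul_zero, zero_add] at hy
        exact hy.symm⟩
  exact Module.Projective.of_equiv e

/-- A free `R[X]`-module is also projective over `R`, so a single kernel serves as syzygy over both
rings. -/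
lemma Polynomial.hasProjectiveDimensionLE_succ {R : Type u} [CommRing R] (n : ℕ) :
    ∀ (M : Type u) [AddCommGroup M] [Module R M] [Module R[X] M] [IsScalarTower R R[X] M],
      HasProjectiveDimensionLE (ModuleCat.of R M) n →
        HasProjectiveDimensionLE (ModuleCat.of R[X] M) (n + 1) := by
  induction n with
  | zero =>
    intro M _ _ _ _ h
    rw [hasProjectiveDimensionLE_zero_iff_projective] at h
    exact hasProjectiveDimensionLE_one
  | succ n ih =>
    intro M _ _ _ _ h
    let p : (M →₀ R[X]) →ₗ[R[X]] M := Finsupp.linearCombination R[X] id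
    have hp : Function.Surjective p := Finsupp.linearCombination_id_surjective R[X] M
    rw [hasProjectiveDimensionLE_succ_iff_ker hp]
    refine ih _ ?_
    have := (hasProjectiveDimensionLE_succ_iff_ker (p := p.restrictScalars R) hp n).mp h
    exact this

attribute [local instance] RingHomInvPair.of_ringEquiv in
lemma MvPolynomial.hasProjectiveDimensionLE_add {R : Type u} [CommRing R] (d n : ℕ) :
    ∀ (M : Type u) [AddCommGroup M] [Module R M] [Module (MvPolynomial (Fin n) R) M]
      [IsScalarTower R (MvPolynomial (Fin n) R) M],
      HasProjectiveDimensionLE (ModuleCat.of R M) d →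
        HasProjectiveDimensionLE (ModuleCat.of (MvPolynomial (Fin n) R) M) (d + n) := by
  induction n with
  | zero =>
    intro M _ _ _ _ h
    let e : R ≃+* MvPolynomial (Fin 0) R := (isEmptyRingEquiv R (Fin 0)).symm
    let e' : M ≃ₛₗ[RingHomClass.toRingHom e] M :=
      { AddEquiv.refl M with
        map_smul' := fun r m ↦ by
          have : e r = algebraMap R _ r := by simp [e, isEmptyRingEquiv_symm_apply, algebraMap_eq]
          change r • m = e r • m
          rw [this, algebraMap_smul] }
    exact ModuleCat.hasProjectiveDimensionLE_of_semiLinearEquiv (M := ModuleCat.of R M)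
      (N := ModuleCat.of (MvPolynomial (Fin 0) R) M) e e' d
  | succ n ih =>
    intro M _ _ _ _ h
    let e : (MvPolynomial (Fin n) R)[X] ≃+* MvPolynomial (Fin (n + 1)) R :=
      (finSuccEquiv R n).symm.toRingEquiv
    let : Module (MvPolynomial (Fin n) R)[X] M := Module.compHom M e.toRingHom
    let : Module (MvPolynomial (Fin n) R) M :=
      Module.compHom M (algebraMap (MvPolynomial (Fin n) R) (MvPolynomial (Fin n) R)[X])
    have : IsScalarTower (MvPolynomial (Fin n) R) (MvPolynomial (Fin n) R)[X] M :=
      IsScalarTower.of_algebraMap_smul fun _ _ ↦ rfl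
    have : IsScalarTower R (MvPolynomial (Fin n) R) M := IsScalarTower.of_algebraMap_smul fun r m ↦ by
      change e (algebraMap R (MvPolynomial (Fin n) R)[X] r) • m = r • m
      have : e (algebraMap R (MvPolynomial (Fin n) R)[X] r) = algebraMap R _ r :=
        (finSuccEquiv R n).symm.commutes r
      rw [this, algebraMap_smul]
    have := Polynomial.hasProjectiveDimensionLE_succ (d + n) M (ih M h)
    let e' : M ≃ₛₗ[RingHomClass.toRingHom e] M :=
      { AddEquiv.refl M with map_smul' := fun r m ↦ rfl }
    exact ModuleCat.hasProjectiveDimensionLE_of_semiLinearEquiv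
      (M := ModuleCat.of (MvPolynomial (Fin n) R)[X] M)
      (N := ModuleCat.of (MvPolynomial (Fin (n + 1)) R) M) e e' (d + n + 1)

attribute [local instance] RingHomInvPair.of_ringEquiv in
/-- Projective dimension does not increase when a module over a localization `A'` of `A` is
restricted to `A`. -/
lemma hasProjectiveDimensionLE_of_isLocalization {A A' M : Type u} [CommRing A] [CommRing A']
    [Algebra A A'] (S : Submonoid A) [IsLocalization S A'] [AddCommGroup M] [Module A M]
    [Module A' M] [IsScalarTower A A' M] (n : ℕ)
    (h : HasProjectiveDimensionLE (ModuleCat.of A M) n) :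
    HasProjectiveDimensionLE (ModuleCat.of A' M) n := by
  let e : Localization S ≃ₐ[A] A' := IsLocalization.algEquiv S _ _
  let : Module (Localization S) M := Module.compHom M e.toRingEquiv.toRingHom
  have : IsScalarTower A (Localization S) M := IsScalarTower.of_algebraMap_smul fun r m ↦ by
    change e (algebraMap A _ r) • m = r • m
    rw [e.commutes, algebraMap_smul]
  -- `S` already acts invertibly on `M`, so `M` is its own localization.
  have := isLocalizedModule_id S M (Localization S)
  have := (ModuleCat.of A M).localizedModule_isLocalizedModule S
  let g : (ModuleCat.of A M).localizedModule S ≃ₗ[Localization S] M :=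
    (IsLocalizedModule.linearEquiv S ((ModuleCat.of A M).localizedModuleMkLinearMap S)
      (LinearMap.id : M →ₗ[A] M)).extendScalarsOfIsLocalization S (Localization S)
  have h1 := ModuleCat.localizedModule_hasProjectiveDimensionLE n S (ModuleCat.of A M)
  have h2 : HasProjectiveDimensionLE (ModuleCat.of (Localization S) M) n :=
    ModuleCat.hasProjectiveDimensionLE_of_linearEquiv g n
  let e' : M ≃ₛₗ[RingHomClass.toRingHom e.toRingEquiv] M :=
    { AddEquiv.refl M with map_smul' := fun r m ↦ rfl }
  exact ModuleCat.hasProjectiveDimensionLE_of_semiLinearEquiv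
    (M := ModuleCat.of (Localization S) M) (N := ModuleCat.of A' M) e.toRingEquiv e' n

end PolynomialDimension

/-! ### Ranks at associated primes and the existence of regular elements. -/

section Rank

open IsLocalRing TensorProduct

/-- The coordinates of `x` in a basis are killed by the nonzero `s`, hence are not units. -/
lemma IsLocalRing.mem_maximalIdeal_smul_top_of_smul_eq_zero {A M : Type*} [CommRing A]
    [IsLocalRing A] [AddCommGroup M] [Module A M] [Module.Free A M] {s : A} (hs0 : s ≠ 0) {x : M}
    (hx : s • x = 0) : x ∈ maximalIdeal A • (⊤ : Submodule A M) := by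
  let b := Module.Free.chooseBasis A M
  rw [← b.linearCombination_repr x, Finsupp.linearCombination_apply, Finsupp.sum]
  refine Submodule.sum_mem _ fun i _ ↦ Submodule.smul_mem_smul ?_ trivial
  rw [mem_maximalIdeal, mem_nonunits_iff]
  intro hu
  refine hs0 (hu.mul_left_eq_zero.mp ?_)
  have := DFunLike.congr_fun (congrArg b.repr hx) i
  simpa using this

lemma IsLocalRing.one_tmul_eq_zero_iff {A M : Type*} [CommRing A] [IsLocalRing A] [AddCommGroup M]
    [Module A M] (x : M) :
    (1 : ResidueField A) ⊗ₜ[A] x = 0 ↔ x ∈ maximalIdeal A • (⊤ : Submodule A M) := by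
  rw [← LinearMap.ker_tensorProductMk]
  rfl

/-- Over a local ring of depth zero, an injective map of finite free modules splits. -/
lemma IsLocalRing.exists_leftInverse_of_injective_of_depth_zero {A M N : Type*} [CommRing A]
    [IsLocalRing A] [AddCommGroup M] [Module A M] [Module.Free A M] [Module.Finite A M]
    [AddCommGroup N] [Module A N] [Module.Free A N] [Module.Finite A N] {s : A} (hs0 : s ≠ 0)
    (hs : ∀ a ∈ maximalIdeal A, a * s = 0) {l : M →ₗ[A] N} (hl : Function.Injective l) :
    ∃ l' : N →ₗ[A] M, l' ∘ₗ l = LinearMap.id := by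
  rw [IsLocalRing.split_injective_iff_lTensor_residueField_injective, injective_iff_map_eq_zero]
  intro z hz
  obtain ⟨x, rfl⟩ := TensorProduct.mk_surjective A M (ResidueField A) residue_surjective z
  refine (one_tmul_eq_zero_iff x).mpr ?_
  rw [TensorProduct.mk_apply, LinearMap.lTensor_tmul] at hz
  have hz : l x ∈ maximalIdeal A • (⊤ : Submodule A N) := (one_tmul_eq_zero_iff (l x)).mp hz
  refine mem_maximalIdeal_smul_top_of_smul_eq_zero hs0 (hl ?_)
  rw [map_smul, map_zero]
  refine Submodule.smul_induction_on hz ?_ ?_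
  · intro a ha n _
    rw [smul_smul, mul_comm, hs a ha, zero_smul]
  · intro x y hx hy
    rw [smul_add, hx, hy, add_zero]

lemma IsLocalRing.free_of_exact_of_depth_zero {A M N L : Type*} [CommRing A]
    [IsLocalRing A] [AddCommGroup M] [Module A M] [Module.Free A M] [Module.Finite A M]
    [AddCommGroup N] [Module A N] [Module.Free A N] [Module.Finite A N] [AddCommGroup L]
    [Module A L] [Module.Finite A L] {s : A} (hs0 : s ≠ 0)
    (hs : ∀ a ∈ maximalIdeal A, a * s = 0) {l : M →ₗ[A] N} (hl : Function.Injective l)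
    {g : N →ₗ[A] L} (hg : Function.Surjective g) (hlg : Function.Exact l g) :
    Module.Free A L ∧ Module.finrank A N = Module.finrank A M + Module.finrank A L := by
  obtain ⟨l', hl'⟩ := IsLocalRing.exists_leftInverse_of_injective_of_depth_zero hs0 hs hl
  obtain ⟨e, -, -⟩ := hlg.splitInjectiveEquiv hg ⟨l', hl'⟩
  have := Module.Projective.of_equiv e
  have : Module.Projective A L :=
    Module.Projective.of_split (LinearMap.inr A M L) (LinearMap.snd _ _ _)
      (LinearMap.snd_comp_inr _ _ _)
  have hfree : Module.Free A L := Module.free_of_flat_of_isLocalRing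
  exact ⟨hfree, by rw [e.finrank_eq, Module.finrank_prod]⟩

/-- If `P` is the annihilator of `x`, the image of `x` in the localization is the required socle
element. -/
lemma Localization.AtPrime.exists_socle_ne_zero {A : Type*} [CommRing A] [IsNoetherianRing A]
    {P : Ideal A} [P.IsPrime] (hP : P ∈ associatedPrimes A A) :
    ∃ s : Localization.AtPrime P, s ≠ 0 ∧
      ∀ a ∈ maximalIdeal (Localization.AtPrime P), a * s = 0 := by
  rw [AssociatedPrimes.mem_iff, isAssociatedPrime_iff] at hP
  obtain ⟨_, x, hx⟩ := hP
  have hx (t : A) : t ∈ P ↔ t * x = 0 := by rw [hx]; simp [Submodule.mem_colon_singleton]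
  refine ⟨algebraMap A _ x, ?_, ?_⟩
  · intro h
    obtain ⟨t, ht⟩ := (IsLocalization.map_eq_zero_iff P.primeCompl (Localization.AtPrime P) x).mp h
    exact t.2 ((hx t).mpr ht)
  · intro a ha
    obtain ⟨r, t, rfl⟩ := IsLocalization.exists_mk'_eq P.primeCompl a
    rw [IsLocalization.AtPrime.mk'_mem_maximal_iff _ P] at ha
    rw [← IsLocalization.mk'_one (M := P.primeCompl) _ x, ← IsLocalization.mk'_mul, (hx r).mp ha,
      IsLocalization.mk'_zero]

/-- A finite module of finite projective dimension over a Noetherian local ring is free of constant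
rank at the associated primes of the ring. -/
lemma exists_finrank_localizedModule_eq {A : Type u} [CommRing A] [IsNoetherianRing A]
    [IsLocalRing A] (n : ℕ) : ∀ (M : Type u) [AddCommGroup M] [Module A M] [Module.Finite A M],
      HasProjectiveDimensionLE (ModuleCat.of A M) n →
      ∃ k : ℤ, ∀ (P : Ideal A) [P.IsPrime], P ∈ associatedPrimes A A →
        Module.Free (Localization.AtPrime P) (LocalizedModule P.primeCompl M) ∧
        (Module.finrank (Localization.AtPrime P) (LocalizedModule P.primeCompl M) : ℤ) = k := by
  have free (M : Type u) [AddCommGroup M] [Module A M] [Module.Finite A M] [Module.Free A M]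
      (P : Ideal A) [P.IsPrime] :
        Module.Free (Localization.AtPrime P) (LocalizedModule P.primeCompl M) ∧
        Module.finrank (Localization.AtPrime P) (LocalizedModule P.primeCompl M) =
          Module.finrank A M := by
    have := Module.free_of_isLocalizedModule (Rₛ := Localization.AtPrime P) P.primeCompl
      (LocalizedModule.mkLinearMap P.primeCompl M)
    exact ⟨this, Module.finrank_of_isLocalizedModule_of_free _ P.primeCompl
      (LocalizedModule.mkLinearMap P.primeCompl M)⟩
  induction n with
  | zero =>
    intro M _ _ _ h
    rw [hasProjectiveDimensionLE_zero_iff_projective] at h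
    have : Module.Free A M := Module.free_of_flat_of_isLocalRing
    exact ⟨Module.finrank A M, fun P _ _ ↦ ⟨(free M P).1, by rw [(free M P).2]⟩⟩
  | succ n ih =>
    intro M _ _ _ h
    obtain ⟨m, p, hp⟩ := Module.Finite.exists_fin' A M
    let F := ULift.{u} (Fin m) → A
    obtain ⟨p, hp⟩ : ∃ p : F →ₗ[A] M, Function.Surjective p :=
      ⟨p ∘ₗ (LinearEquiv.funCongrLeft A A Equiv.ulift.symm).toLinearMap,
        hp.comp (LinearEquiv.surjective _)⟩
    rw [hasProjectiveDimensionLE_succ_iff_ker hp] at h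
    obtain ⟨k, hk⟩ := ih (LinearMap.ker p) h
    -- Additivity of rank along `0 → ker p → F → M → 0`; working in `ℤ` keeps the subtraction from
    -- truncating.
    refine ⟨m - k, fun P _ hP ↦ ?_⟩
    obtain ⟨hKfree, hKrank⟩ := hk P hP
    obtain ⟨hFfree, hFrank⟩ := free F P
    let l := LocalizedModule.map P.primeCompl (LinearMap.ker p).subtype
    let g := LocalizedModule.map P.primeCompl p
    have hl : Function.Injective l :=
      LocalizedModule.map_injective P.primeCompl _ (Submodule.injective_subtype _)
    have hg : Function.Surjective g := LocalizedModule.map_surjective P.primeCompl _ hp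
    have hlg : Function.Exact l g := LocalizedModule.map_exact P.primeCompl _ _
      (LinearMap.exact_subtype_ker_map p)
    obtain ⟨s, hs0, hs⟩ := Localization.AtPrime.exists_socle_ne_zero hP
    obtain ⟨hfree, h1⟩ := IsLocalRing.free_of_exact_of_depth_zero (A := Localization.AtPrime P)
      (M := LocalizedModule P.primeCompl (LinearMap.ker p)) (N := LocalizedModule P.primeCompl F)
      (L := LocalizedModule P.primeCompl M) hs0 hs hl hg hlg
    refine ⟨hfree, ?_⟩
    rw [hFrank] at h1
    have h2 : Module.finrank A F = m := by simp [F]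
    omega

/-- A nonzero ideal `I` of a Noetherian local ring such that `A / I` has finite projective dimension
contains a regular element. -/
lemma exists_mem_ker_nonZeroDivisors {A B : Type u} [CommRing A] [IsNoetherianRing A]
    [IsLocalRing A] [CommRing B] [Algebra A B] (hs : Function.Surjective (algebraMap A B)) {n : ℕ}
    (h : HasProjectiveDimensionLE (ModuleCat.of A B) n)
    (h0 : RingHom.ker (algebraMap A B) ≠ ⊥) :
    ∃ a ∈ RingHom.ker (algebraMap A B), a ∈ nonZeroDivisors A := by
  by_contra! hcon
  have : Module.Finite A B := Module.Finite.of_surjective (Algebra.linearMap A B) hs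
  obtain ⟨k, hk⟩ := exists_finrank_localizedModule_eq n B h
  -- Prime avoidance: an ideal of zero divisors lies in one associated prime. There `B` does not
  -- localize to zero, so its constant rank is positive.
  obtain ⟨P₀, hP₀, hI⟩ : ∃ P ∈ associatedPrimes A A, RingHom.ker (algebraMap A B) ≤ P := by
    refine ((RingHom.ker (algebraMap A B)).subset_union_prime_finite (associatedPrimes.finite A A)
      (f := id) ⊥ ⊥ fun _ h _ _ ↦ h.1).1 ?_
    intro x hx
    simp_rw [id, biUnion_associatedPrimes_eq_compl_nonZeroDivisors]
    exact hcon x hx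
  have : P₀.IsPrime := hP₀.1
  have hkpos : 0 < k := by
    have hnt : Nontrivial (LocalizedModule P₀.primeCompl B) := by
      refine nontrivial_of_ne (LocalizedModule.mkLinearMap P₀.primeCompl B 1) 0 fun h0 ↦ ?_
      obtain ⟨t, ht⟩ := (IsLocalizedModule.eq_zero_iff P₀.primeCompl
        (LocalizedModule.mkLinearMap P₀.primeCompl B)).mp h0
      refine t.2 (hI ?_)
      rwa [Submonoid.smul_def, Algebra.smul_def, mul_one] at ht
    obtain ⟨hfree, hrank⟩ := hk P₀ hP₀
    have := Module.finrank_pos_iff_of_free (Localization.AtPrime P₀)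
      (LocalizedModule P₀.primeCompl B) |>.mpr hnt
    omega
  refine h0 ((Submodule.eq_bot_iff _).mpr fun x hx ↦ ?_)
  by_contra hx0
  -- At a prime `P` containing the annihilator of `x`, the localization of `B` is free and nonzero,
  -- hence faithful, yet `x` kills it. So `x` dies at `P`, against the choice of `P`.
  obtain ⟨P, hP, hle⟩ := exists_le_isAssociatedPrime_of_isNoetherianRing A x hx0
  have : P.IsPrime := hP.1
  obtain ⟨hfree, hrank⟩ := hk P hP
  have : Nontrivial (LocalizedModule P.primeCompl B) :=
    Module.nontrivial_of_finrank_pos (R := Localization.AtPrime P) (by omega)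
  have hann : algebraMap A (Localization.AtPrime P) x ∈
      Module.annihilator (Localization.AtPrime P) (LocalizedModule P.primeCompl B) := by
    rw [Module.mem_annihilator]
    intro m
    rw [algebraMap_smul]
    obtain ⟨⟨b, t⟩, rfl⟩ := IsLocalizedModule.mk'_surjective P.primeCompl
      (LocalizedModule.mkLinearMap P.primeCompl B) m
    rw [Function.uncurry_apply_pair, ← IsLocalizedModule.mk'_smul, Algebra.smul_def,
      RingHom.mem_ker.mp hx, zero_mul, IsLocalizedModule.mk'_zero]
  rw [Module.annihilator_eq_bot.mpr inferInstance, Ideal.mem_bot,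
    IsLocalization.map_eq_zero_iff P.primeCompl] at hann
  obtain ⟨t, ht⟩ := hann
  refine t.2 (hle ?_)
  simpa [Submodule.mem_colon_singleton] using ht

end Rank

/-! ### Vasconcelos' theorem. -/

section Vasconcelos

open IsLocalRing RingTheory.Sequence

/-- Replacing the module `A / fA` by the ring `A / f` allows an induction in which the base ring
changes. -/
lemma isWeaklyRegular_cons_iff_quotient {A : Type*} [CommRing A] (f : A) (rs : List A) :
    IsWeaklyRegular A (f :: rs) ↔ (∀ a, f * a = 0 → a = 0) ∧
      IsWeaklyRegular (A ⧸ Ideal.span {f}) (rs.map (Ideal.Quotient.mk (Ideal.span {f}))) := by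
  have e : QuotSMulTop f A ≃ₗ[A] A ⧸ Ideal.span {f} :=
    Submodule.quotEquivOfEq _ _ (by ext x; simp [Ideal.mem_span_singleton', Submodule.mem_smul_pointwise_iff_exists, mul_comm])
  rw [isWeaklyRegular_cons_iff, e.isWeaklyRegular_congr,
    ← isWeaklyRegular_map_algebraMap_iff (A ⧸ Ideal.span {f}) (A ⧸ Ideal.span {f}) rs]
  refine and_congr_left fun _ ↦ ?_
  rw [isSMulRegular_iff_right_eq_zero_of_smul]
  rfl

/-- An ideal with finite projective dimension that vanishes at a prime containing it is zero. -/
lemma ker_algebraMap_eq_bot_of_forall_exists_mul_mem_sq {A B : Type u} [CommRing A]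
    [IsNoetherianRing A] [IsLocalRing A] [CommRing B] [Algebra A B]
    (hs : Function.Surjective (algebraMap A B)) {n : ℕ}
    (h : HasProjectiveDimensionLE (ModuleCat.of A B) n) {q : Ideal B} [q.IsPrime]
    (hN : ∀ x ∈ RingHom.ker (algebraMap A B), ∃ s : A, algebraMap A B s ∉ q ∧
      s * x ∈ RingHom.ker (algebraMap A B) ^ 2) : RingHom.ker (algebraMap A B) = ⊥ := by
  by_contra h0
  obtain ⟨a, ha, ha'⟩ := exists_mem_ker_nonZeroDivisors hs h h0
  set I := RingHom.ker (algebraMap A B)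
  let Q := q.comap (algebraMap A B)
  let AQ := Localization.AtPrime Q
  have hIQ : I ≤ Q := Ideal.ker_le_comap _
  -- At `Q` the hypothesis says `I ≤ I²`, so Nakayama applies. A regular element of `I` then dies at
  -- `Q`, which is impossible.
  have hbot : I.map (algebraMap A AQ) = ⊥ := by
    refine Submodule.eq_bot_of_le_smul_of_le_jacobson_bot (I.map (algebraMap A AQ)) _
      (IsNoetherian.noetherian _) ?_ ?_
    · rw [Ideal.map_le_iff_le_comap]
      intro x hx
      obtain ⟨s, hsq, hsx⟩ := hN x hx
      have hu : IsUnit (algebraMap A AQ s) := IsLocalization.map_units AQ (⟨s, hsq⟩ : Q.primeCompl)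
      rw [Ideal.mem_comap, smul_eq_mul, ← Ideal.unit_mul_mem_iff_mem _ hu, ← map_mul,
        ← Ideal.map_mul, ← pow_two]
      exact Ideal.mem_map_of_mem _ hsx
    · rw [IsLocalRing.jacobson_eq_maximalIdeal _ bot_ne_top, ← Localization.AtPrime.map_eq_maximalIdeal]
      exact Ideal.map_mono hIQ
  have : algebraMap A AQ a = 0 := by
    rw [← Ideal.mem_bot, ← hbot]
    exact Ideal.mem_map_of_mem _ ha
  rw [IsLocalization.map_eq_zero_iff Q.primeCompl] at this
  obtain ⟨t, ht⟩ := this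
  refine t.2 ?_
  rw [(mul_right_mem_nonZeroDivisors_eq_zero_iff ha').mp ht]
  exact Q.zero_mem

/-- If a linear form on `I` with values in `B = A / I` maps `f ∈ I` to `1`, then `B` has finite
projective dimension over `A / f` as soon as it does over `A`. -/
lemma hasProjectiveDimensionLE_of_linearForm {A B : Type u} [CommRing A]
    [CommRing B] [Algebra A B] (f : RingHom.ker (algebraMap A B))
    [Algebra (A ⧸ Ideal.span {(f : A)}) B] [IsScalarTower A (A ⧸ Ideal.span {(f : A)}) B]
    (hs : Function.Surjective (algebraMap A B)) {n : ℕ}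
    (h : HasProjectiveDimensionLE (ModuleCat.of A B) n)
    (hf : ∀ a : A, f * a = 0 → a = 0)
    (ψ : RingHom.ker (algebraMap A B) →ₗ[A] B) (hψ : ψ f = 1) :
    HasProjectiveDimensionLE (ModuleCat.of (A ⧸ Ideal.span {(f : A)}) B) n := by
  let I := RingHom.ker (algebraMap A B)
  have hs' : Function.Surjective (algebraMap A (A ⧸ Ideal.span {(f : A)})) :=
    Ideal.Quotient.mk_surjective
  let N := I ⧸ (Ideal.span {(f : A)} • ⊤ : Submodule A I)
  let π : I →ₗ[A] N := Submodule.mkQ _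
  have hπ : Function.Surjective π := Submodule.mkQ_surjective _
  have hπ0 (x : I) : π x = 0 ↔ ∃ y : I, x = (f : A) • y := by
    rw [Submodule.mkQ_apply, Submodule.Quotient.mk_eq_zero,
      Submodule.ideal_span_singleton_smul, Submodule.mem_smul_pointwise_iff_exists]
    simp only [Submodule.mem_top, true_and, eq_comm]
  have hIn : HasProjectiveDimensionLE (ModuleCat.of A I) n :=
    hasProjectiveDimensionLE_ker (p := Algebra.linearMap A B) hs n h
  have hN : HasProjectiveDimensionLE (ModuleCat.of (A ⧸ Ideal.span {(f : A)}) N) n := by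
    refine hasProjectiveDimensionLE_of_ker_eq_range_smul hs' hf (fun a ↦ ?_) n I N π hπ hπ0 ?_ hIn
    · rw [Ideal.Quotient.algebraMap_eq, Ideal.Quotient.eq_zero_iff_mem, Ideal.mem_span_singleton]
      rfl
    · exact fun x hx ↦ Subtype.ext (hf x (congrArg Subtype.val hx))
  have hmem (a : A) : algebraMap A B a = 0 ↔ a ∈ I := Iff.rfl
  -- `i` sends `1` to the class of `f` in `I / fI`, and `r` is induced by `ψ`. Since `ψ f = 1`, they
  -- make `B` a retract of `I / fI`.
  obtain ⟨i, hi⟩ := LinearMap.exists_extendScalars_factor (h := Algebra.linearMap A B) (L := N) hs' hs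
    (π ∘ₗ LinearMap.toSpanSingleton A I f) (fun a ha ↦ by
      refine (hπ0 _).mpr ⟨⟨a, ha⟩, Subtype.ext ?_⟩
      simp [mul_comm])
  obtain ⟨r, hr⟩ := LinearMap.exists_extendScalars_factor (h := π) (L := B) hs' hπ ψ (fun x hx ↦ by
      obtain ⟨y, rfl⟩ := (hπ0 x).mp hx
      rw [map_smul, Algebra.smul_def, (hmem f).mpr f.2, zero_mul])
  have hri : r ∘ₗ i = LinearMap.id := by
    ext b
    obtain ⟨a, rfl⟩ := hs b
    have := hi a
    rw [Algebra.linearMap_apply] at this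
    simp [this, hr, hψ, Algebra.smul_def]
  let ret : Retract (ModuleCat.of (A ⧸ Ideal.span {(f : A)}) B)
      (ModuleCat.of (A ⧸ Ideal.span {(f : A)}) N) :=
    { i := ModuleCat.ofHom i
      r := ModuleCat.ofHom r
      retract := by rw [← ModuleCat.ofHom_comp, hri]; rfl }
  exact ret.hasProjectiveDimensionLT (n + 1)

/-- Prime avoidance for `J` and the associated primes together; `J` need not be prime, since one
exceptional ideal is harmless. -/
lemma Ideal.exists_mem_and_notMem_of_associatedPrimes {A : Type*} [CommRing A] [IsNoetherianRing A]
    {I J : Ideal A} (hIJ : ¬ I ≤ J) (h : ∃ a ∈ I, a ∈ nonZeroDivisors A) :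
    ∃ a ∈ I, a ∉ J ∧ a ∈ nonZeroDivisors A := by
  by_contra! hcon
  have := ((I.subset_union_prime_finite ((associatedPrimes.finite A A).insert J)
      (f := id) J J fun P h hJ _ ↦ by
        rcases h with h | h
        · exact absurd h hJ
        · exact h.1).1 ?_)
  · obtain ⟨P, hP | hP, hIP⟩ := this
    · subst hP
      exact hIJ hIP
    · obtain ⟨a, ha, ha'⟩ := h
      have h1 : a ∈ ⋃ P ∈ associatedPrimes A A, (P : Set A) := Set.mem_biUnion hP (hIP ha)
      rw [biUnion_associatedPrimes_eq_compl_nonZeroDivisors] at h1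
      exact h1 ha'
  · intro x hx
    rw [Set.biUnion_insert]
    by_cases hxJ : x ∈ J
    · exact Or.inl hxJ
    · refine Or.inr ?_
      simp_rw [id, biUnion_associatedPrimes_eq_compl_nonZeroDivisors]
      exact hcon x hx hxJ

/-- A version of Vasconcelos' theorem: let `I` be the kernel of a surjection `A → B` of Noetherian
local rings such that `B` has finite projective dimension over `A`. If `I` has a surjection onto a
free `B`-module whose kernel agrees with `I ^ 2` at the minimal primes of `B`, then `I` is generated
by a regular sequence. -/
theorem exists_isWeaklyRegular_ker_eq_ofList {B : Type u} [CommRing B] [Nontrivial B] (n r : ℕ) :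
    ∀ (A : Type u) [CommRing A] [IsNoetherianRing A] [IsLocalRing A] [Algebra A B]
      (_ : Function.Surjective (algebraMap A B))
      (_ : HasProjectiveDimensionLE (ModuleCat.of A B) n)
      (φ : RingHom.ker (algebraMap A B) →ₗ[A] (Fin r → B)) (_ : Function.Surjective φ)
      (_ : ∀ x, φ x = 0 → ∀ q ∈ minimalPrimes B, ∃ s : A, algebraMap A B s ∉ q ∧
        s * x ∈ RingHom.ker (algebraMap A B) ^ 2),
      ∃ rs : List A, IsWeaklyRegular A rs ∧ RingHom.ker (algebraMap A B) = Ideal.ofList rs := by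
  induction r with
  | zero =>
    intro A _ _ _ _ hs hpd φ hφ hN
    obtain ⟨q, hq⟩ := Ideal.nonempty_minimalPrimes (bot_ne_top (α := Ideal B))
    have : q.IsPrime := hq.1.1
    refine ⟨[], IsWeaklyRegular.nil _ _, ?_⟩
    rw [Ideal.ofList_nil]
    exact ker_algebraMap_eq_bot_of_forall_exists_mul_mem_sq hs hpd
      fun x hx ↦ hN ⟨x, hx⟩ (Subsingleton.elim _ _) q hq
  | succ r ih =>
    intro A _ _ _ _ hs hpd φ hφ hN
    have : IsLocalRing B := IsLocalRing.of_surjective' _ hs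
    obtain ⟨x₁, hx₁⟩ := hφ 1
    let φ₀ : RingHom.ker (algebraMap A B) →ₗ[A] B := LinearMap.proj 0 ∘ₗ φ
    -- The elements of the kernel whose first coordinate is not a unit; `f` has to avoid them and be
    -- regular.
    let J : Ideal A := Submodule.map (Submodule.subtype _)
      (Submodule.comap φ₀ ((maximalIdeal B).restrictScalars A))
    have hJ : ¬ RingHom.ker (algebraMap A B) ≤ J := by
      intro hle
      obtain ⟨y, hy, hyx⟩ := hle x₁.2
      rw [Submodule.subtype_apply, ← Subtype.ext_iff] at hyx
      subst hyx
      have : φ₀ y = 1 := by simp [φ₀, hx₁]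
      simp [this] at hy
    have h0 : RingHom.ker (algebraMap A B) ≠ ⊥ := fun h ↦ hJ (h ▸ bot_le)
    obtain ⟨f, hfI, hfJ, hf⟩ := Ideal.exists_mem_and_notMem_of_associatedPrimes hJ
      (exists_mem_ker_nonZeroDivisors hs hpd h0)
    have hf (a : A) (h : f * a = 0) : a = 0 := (mul_left_mem_nonZeroDivisors_eq_zero_iff hf).mp h
    obtain ⟨u, hu⟩ : ∃ u, u * φ ⟨f, hfI⟩ 0 = 1 := by
      have : IsUnit (φ ⟨f, hfI⟩ 0) := by
        by_contra hcon
        exact hfJ ⟨⟨f, hfI⟩, hcon, rfl⟩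
      exact this.exists_left_inv
    let A' := A ⧸ Ideal.span {f}
    let g : A' →+* B := Ideal.Quotient.lift (Ideal.span {f}) (algebraMap A B) fun a ha ↦ by
      obtain ⟨b, rfl⟩ := Ideal.mem_span_singleton.mp ha
      rw [map_mul, RingHom.mem_ker.mp hfI, zero_mul]
    algebraize [g]
    have : IsScalarTower A A' B := IsScalarTower.of_algebraMap_eq fun _ ↦ rfl
    have hs' : Function.Surjective (algebraMap A A') := Ideal.Quotient.mk_surjective
    have hsB : Function.Surjective (algebraMap A' B) := fun b ↦ by
      obtain ⟨a, rfl⟩ := hs b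
      exact ⟨algebraMap A A' a, rfl⟩
    have : Nontrivial A' := RingHom.domain_nontrivial g
    have : IsLocalRing A' := IsLocalRing.of_surjective' _ hs'
    have hpd' : HasProjectiveDimensionLE (ModuleCat.of A' B) n :=
      hasProjectiveDimensionLE_of_linearForm ⟨f, hfI⟩ hs hpd hf
        (LinearMap.lsmul B B u |>.restrictScalars A |>.comp φ₀) hu
    have hker : RingHom.ker (algebraMap A' B) =
        (RingHom.ker (algebraMap A B)).map (algebraMap A A') := by
      ext y
      obtain ⟨x, rfl⟩ := hs' y
      rw [Ideal.mem_map_iff_of_surjective _ hs']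
      refine ⟨fun h ↦ ⟨x, h, rfl⟩, ?_⟩
      rintro ⟨z, hz, hzx⟩
      rw [← hzx]
      exact hz
    let π : RingHom.ker (algebraMap A B) →ₗ[A] RingHom.ker (algebraMap A' B) :=
      { toFun := fun x ↦ ⟨algebraMap A A' x, x.2⟩
        map_add' := fun x y ↦ by ext1; simp
        map_smul' := fun a x ↦ by ext1; simp [Algebra.smul_def] }
    have hπ : Function.Surjective π := by
      rintro ⟨y, hy⟩
      obtain ⟨x, rfl⟩ := hs' y
      exact ⟨⟨x, hy⟩, rfl⟩
    -- Gaussian elimination: subtracting multiples of coordinate `0` makes the other `r` coordinates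
    -- vanish at `f`, so they descend to the kernel of `A' → B`.
    let ψ : RingHom.ker (algebraMap A B) →ₗ[A] (Fin r → B) := LinearMap.pi fun i ↦
      LinearMap.proj i.succ ∘ₗ φ - (LinearMap.lsmul B B (u * φ ⟨f, hfI⟩ i.succ)).restrictScalars A ∘ₗ φ₀
    have hψ (x) (i : Fin r) : ψ x i = φ x i.succ - u * φ ⟨f, hfI⟩ i.succ * φ x 0 := rfl
    have hψsurj : Function.Surjective ψ := by
      intro v
      obtain ⟨x, hx⟩ := hφ (Fin.cons 0 v)
      refine ⟨x, ?_⟩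
      ext i
      simp [hψ, hx]
    obtain ⟨φ', hφ'⟩ := LinearMap.exists_extendScalars_factor (h := π) (L := Fin r → B) hs' hπ ψ
      (fun x hx ↦ by
        have : (x : A) ∈ Ideal.span {f} := Ideal.Quotient.eq_zero_iff_mem.mp (congrArg Subtype.val hx)
        obtain ⟨b, hb⟩ := Ideal.mem_span_singleton.mp this
        have : x = b • ⟨f, hfI⟩ := by ext1; simpa [mul_comm] using hb
        ext i
        rw [hψ, this, map_smul, Pi.smul_apply, Pi.smul_apply, Pi.zero_apply, Algebra.smul_def,
          Algebra.smul_def]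
        linear_combination (- algebraMap A B b * φ ⟨f, hfI⟩ i.succ) * hu)
    obtain ⟨rs', hreg, hrs'⟩ := ih A' hsB hpd' φ' (fun v ↦ by
        obtain ⟨x, rfl⟩ := hψsurj v
        exact ⟨π x, hφ' x⟩) (fun y hy q hq ↦ by
        obtain ⟨x, rfl⟩ := hπ y
        rw [hφ'] at hy
        -- With this `a`, all coordinates of `x - a f` vanish, and it has the same image in `A'` as
        -- `x`.
        obtain ⟨a, ha⟩ := hs (u * φ x 0)
        obtain ⟨s, hsq, hsx⟩ := hN (x - a • ⟨f, hfI⟩) (by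
          rw [map_sub, map_smul, sub_eq_zero]
          ext i
          rw [Pi.smul_apply, Algebra.smul_def, ha]
          refine Fin.cases ?_ (fun i ↦ ?_) i
          · linear_combination (- φ x 0) * hu
          · have := congrFun hy i
            rw [hψ, Pi.zero_apply] at this
            linear_combination this) q hq
        refine ⟨algebraMap A A' s, hsq, ?_⟩
        have := Ideal.mem_map_of_mem (algebraMap A A') hsx
        rw [Ideal.map_pow, ← hker] at this
        have hf0 : algebraMap A A' f = 0 :=
          Ideal.Quotient.eq_zero_iff_mem.mpr (Ideal.mem_span_singleton_self f)
        rw [Submodule.coe_sub, Submodule.coe_smul, smul_eq_mul, mul_sub, map_sub, map_mul, map_mul,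
          map_mul, hf0, mul_zero, mul_zero, sub_zero] at this
        exact this)
    obtain ⟨rs, rfl⟩ := hs'.list_map rs'
    refine ⟨f :: rs, (isWeaklyRegular_cons_iff_quotient f rs).mpr ⟨hf, hreg⟩, ?_⟩
    ext x
    rw [Ideal.ofList_cons, sup_comm, ← Ideal.mem_quotient_iff_mem_sup, Ideal.map_ofList]
    exact SetLike.ext_iff.mp hrs' (algebraMap A A' x)

end Vasconcelos

/-! ### Relations on regular sequences, and spreading out from a local ring. -/

section RegularSequences

open RingTheory.Sequence

lemma isWeaklyRegular_self_iff {A : Type*} [CommRing A] (rs : List A) :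
    IsWeaklyRegular A rs ↔ ∀ (i : ℕ) (h : i < rs.length) (x : A),
      rs[i] * x ∈ Ideal.ofList (rs.take i) → x ∈ Ideal.ofList (rs.take i) := by
  rw [isWeaklyRegular_iff]
  refine forall₂_congr fun i h ↦ ?_
  rw [isSMulRegular_iff_right_eq_zero_of_smul]
  refine ⟨fun H x hx ↦ ?_, fun H x ↦ ?_⟩
  · have := H (Submodule.Quotient.mk x)
    rw [← Submodule.Quotient.mk_smul, Submodule.Quotient.mk_eq_zero,
      Submodule.Quotient.mk_eq_zero] at this
    simpa using this (by simpa using hx)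
  · obtain ⟨x, rfl⟩ := Submodule.Quotient.mk_surjective _ x
    rw [← Submodule.Quotient.mk_smul, Submodule.Quotient.mk_eq_zero,
      Submodule.Quotient.mk_eq_zero]
    simpa using H x

/-- By regularity the last coefficient is a combination `∑ d j * f j` of earlier terms. Substituting
gives a shorter relation with coefficients `c j + d j * f k`. -/
lemma mem_span_of_sum_mul_eq_zero {A : Type*} [CommRing A] (f : ℕ → A) (k : ℕ)
    (hf : ∀ i < k, ∀ x, f i * x ∈ Ideal.span (f '' (Finset.range i)) →
      x ∈ Ideal.span (f '' (Finset.range i))) :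
    ∀ c : ℕ → A, ∑ i ∈ Finset.range k, c i * f i = 0 →
      ∀ i < k, c i ∈ Ideal.span (f '' (Finset.range k)) := by
  induction k with
  | zero => intro c _ i hi; omega
  | succ k ih =>
    intro c hc i hi
    have hle : Ideal.span (f '' (Finset.range k)) ≤ Ideal.span (f '' (Finset.range (k + 1))) :=
      Ideal.span_mono (Set.image_mono (by simp))
    rw [Finset.sum_range_succ] at hc
    have hck : c k ∈ Ideal.span (f '' (Finset.range k)) := by
      refine hf k (by omega) _ ?_
      rw [mul_comm, eq_neg_of_add_eq_zero_right hc]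
      exact neg_mem (Ideal.sum_mem _ fun j hj ↦ Ideal.mul_mem_left _ _
        (Ideal.subset_span ⟨j, hj, rfl⟩))
    obtain rfl | hik := eq_or_ne i k
    · exact hle hck
    obtain ⟨d, hd⟩ := (Submodule.mem_span_image_finset_iff_exists_fun' A).mp hck
    have := ih (fun i hi ↦ hf i (by omega)) (fun j ↦ c j + d j * f k) (by
      rw [← hc, ← hd, Finset.sum_mul, ← Finset.sum_add_distrib]
      exact Finset.sum_congr rfl fun j _ ↦ by rw [smul_eq_mul]; ring) i (by omega)
    have h2 : d i * f k ∈ Ideal.span (f '' (Finset.range (k + 1))) :=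
      Ideal.mul_mem_left _ _ (Ideal.subset_span ⟨k, by simp, rfl⟩)
    simpa using sub_mem (hle this) h2

/-- An ideal generated by a weakly regular sequence is generated by a finite family whose classes
in `I / I ^ 2` are linearly independent over the quotient. -/
lemma exists_span_range_eq_of_isWeaklyRegular {A : Type*} [CommRing A] {rs : List A}
    (hrs : IsWeaklyRegular A rs) : ∃ (k : ℕ) (f : Fin k → A),
      Ideal.span (Set.range f) = Ideal.ofList rs ∧
      ∀ c : Fin k → A, ∑ i, c i * f i ∈ Ideal.ofList rs ^ 2 → ∀ i, c i ∈ Ideal.ofList rs := by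
  rw [isWeaklyRegular_self_iff] at hrs
  have hspan (j : ℕ) (hj : j ≤ rs.length) :
      Ideal.span ((fun i ↦ rs.getD i 0) '' (Finset.range j)) = Ideal.ofList (rs.take j) := by
    refine congrArg Ideal.span ?_
    ext x
    simp only [Finset.coe_range, Set.mem_image, Set.mem_Iio, Set.mem_ofPred_eq,
      List.mem_take_iff_getElem]
    constructor
    · rintro ⟨i, hi, rfl⟩
      exact ⟨i, by omega, by rw [List.getD_eq_getElem]⟩
    · rintro ⟨i, hi, rfl⟩
      exact ⟨i, by omega, by rw [List.getD_eq_getElem]⟩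
  have hspan' : Ideal.span (Set.range fun i : Fin rs.length ↦ rs[i]) = Ideal.ofList rs := by
    refine congrArg Ideal.span ?_
    ext x
    simp [List.mem_iff_get]
  refine ⟨rs.length, fun i ↦ rs[i], hspan', fun c hc ↦ ?_⟩
  rw [pow_two, ← smul_eq_mul] at hc
  nth_rw 2 [← hspan'] at hc
  obtain ⟨d, hd, hdc⟩ := (Submodule.mem_ideal_smul_span_iff_exists_sum _ _ _).mp hc
  rw [Finsupp.sum_fintype _ _ (by simp)] at hdc
  -- The sum also has an expression with coefficients `d` in the ideal, so `c - d` is a genuine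
  -- relation. The default `0` only extends the sequence to `ℕ`.
  have key := mem_span_of_sum_mul_eq_zero (fun i ↦ rs.getD i 0) rs.length (fun i hi x hx ↦ by
      rw [hspan i hi.le] at hx ⊢
      refine hrs i hi x ?_
      rwa [List.getD_eq_getElem _ _ hi] at hx)
    (fun i ↦ if h : i < rs.length then c ⟨i, h⟩ - d ⟨i, h⟩ else 0) (by
      rw [Finset.sum_range]
      simp only [Fin.is_lt, dite_true, sub_mul, Finset.sum_sub_distrib]
      rw [sub_eq_zero]
      simpa using hdc.symm)
  rw [hspan _ le_rfl, List.take_length] at key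
  intro i
  have := key i i.2
  rw [dif_pos i.2] at this
  simpa using add_mem this (hd i)

lemma Ideal.ofList_map_mul_of_isUnit {A : Type*} [CommRing A] {u : A} (hu : IsUnit u)
    (rs : List A) : Ideal.ofList (rs.map (u * ·)) = Ideal.ofList rs := by
  induction rs with
  | nil => simp
  | cons r rs ih => rw [List.map_cons, ofList_cons, ofList_cons, ih, span_singleton_mul_left_unit hu]

/-- Each generator of `I` needs one denominator outside `p`; finitely many can be multiplied
together. -/
lemma Ideal.exists_notMem_forall_mul_mem_of_map_le {T : Type*} [CommRing T] (p : Ideal T)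
    [p.IsPrime] (A : Type*) [CommRing A] [Algebra T A] [IsLocalization.AtPrime A p] {I J : Ideal T}
    (hI : I.FG) (h : I.map (algebraMap T A) ≤ J.map (algebraMap T A)) :
    ∃ g, g ∉ p ∧ ∀ x ∈ I, g * x ∈ J := by
  induction I, hI using Submodule.fg_induction with
  | singleton x =>
    have := h (mem_map_of_mem _ (mem_span_singleton_self x))
    obtain ⟨g, hg, hgx⟩ := (IsLocalization.algebraMap_mem_map_algebraMap_iff p.primeCompl A _ _).mp this
    refine ⟨g, hg, fun y hy ↦ ?_⟩
    obtain ⟨z, rfl⟩ := mem_span_singleton.mp hy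
    rw [← mul_assoc]
    exact J.mul_mem_right _ hgx
  | sup I₁ I₂ _ _ h₁ h₂ =>
    obtain ⟨g₁, hg₁, hgx₁⟩ := h₁ ((map_mono le_sup_left).trans h)
    obtain ⟨g₂, hg₂, hgx₂⟩ := h₂ ((map_mono le_sup_right).trans h)
    refine ⟨g₁ * g₂, p.primeCompl.mul_mem hg₁ hg₂, fun x hx ↦ ?_⟩
    obtain ⟨y, hy, z, hz, rfl⟩ := Submodule.mem_sup.mp hx
    have h1 := J.mul_mem_left g₂ (hgx₁ y hy)
    have h2 := J.mul_mem_left g₁ (hgx₂ z hz)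
    convert add_mem h1 h2 using 1
    ring

/-- If the extension of an ideal to the local ring at `p` is generated by a regular sequence, then
so is its extension to `T[1/g]`, for some `g ∉ p`. -/
lemma exists_notMem_isWeaklyRegular_of_isLocalization_atPrime {T : Type*} [CommRing T]
    [IsNoetherianRing T] (p : Ideal T) [p.IsPrime] {A : Type*} [CommRing A] [Algebra T A]
    [IsLocalization.AtPrime A p] (J : Ideal T) {rs : List A} (hrs : IsWeaklyRegular A rs)
    (hJ : J.map (algebraMap T A) = Ideal.ofList rs) :
    ∃ (as : List T) (g : T), g ∉ p ∧ ∀ (T' : Type _) [CommRing T'] [Algebra T T']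
      [IsLocalization.Away g T'], IsWeaklyRegular T' (as.map (algebraMap T T')) ∧
        J.map (algebraMap T T') = Ideal.ofList (as.map (algebraMap T T')) := by
  classical
  -- A common denominator `b` is a unit in `A`, so scaling the sequence by it changes none of the
  -- ideals involved.
  obtain ⟨b, hb⟩ := IsLocalization.exist_integer_multiples_of_finset p.primeCompl rs.toFinset
  have hu : IsUnit (algebraMap T A b) := IsLocalization.map_units A b
  obtain ⟨as, has⟩ : ∃ as : List T, as.map (algebraMap T A) = rs.map (algebraMap T A b * ·) := by
    change _ ∈ Set.range (List.map (algebraMap T A))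
    rw [Set.range_list_map]
    intro y hy
    obtain ⟨r, hr, rfl⟩ := List.mem_map.mp hy
    obtain ⟨a, ha⟩ := hb r (by simpa using hr)
    exact ⟨a, by rw [ha, Algebra.smul_def]⟩
  have hlen : as.length = rs.length := by simpa using congrArg List.length has
  have hmap (i : ℕ) : (Ideal.ofList (as.take i)).map (algebraMap T A) =
      Ideal.ofList (rs.take i) := by
    rw [Ideal.map_ofList, List.map_take, has, ← List.map_take, Ideal.ofList_map_mul_of_isUnit hu]
  have hmap' : (Ideal.ofList as).map (algebraMap T A) = Ideal.ofList rs := by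
    rw [Ideal.map_ofList, has, Ideal.ofList_map_mul_of_isUnit hu]
  rw [isWeaklyRegular_self_iff] at hrs
  -- The colon ideal is finitely generated and collapses at `p`, so one element outside `p`
  -- witnesses regularity of the `i`-th term.
  have hreg (i : Fin as.length) : ∃ g, g ∉ p ∧ ∀ x, as[i] * x ∈ Ideal.ofList (as.take i) →
      g * x ∈ Ideal.ofList (as.take i) := by
    refine Ideal.exists_notMem_forall_mul_mem_of_map_le p A
      (I := Submodule.comap (LinearMap.mulLeft T as[i]) (Ideal.ofList (as.take i)))
      (IsNoetherian.noetherian _) ?_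
    rw [Ideal.map_le_iff_le_comap, hmap]
    intro x hx
    refine hrs i (by omega) _ ?_
    have hx : as[i] * x ∈ Ideal.ofList (as.take i) := hx
    have h1 := Ideal.mem_map_of_mem (algebraMap T A) hx
    have h2 : algebraMap T A as[i] = algebraMap T A b * rs[i]'(by omega) := by
      have := List.getElem_of_eq has (i := i) (by simp)
      simpa using this
    rwa [map_mul, h2, mul_assoc, Ideal.unit_mul_mem_iff_mem _ hu, hmap] at h1
  choose G hG hGx using hreg
  obtain ⟨g₁, hg₁, hgx₁⟩ := Ideal.exists_notMem_forall_mul_mem_of_map_le p A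
    (IsNoetherian.noetherian J) (hJ.trans hmap'.symm).le
  obtain ⟨g₂, hg₂, hgx₂⟩ := Ideal.exists_notMem_forall_mul_mem_of_map_le p A
    (IsNoetherian.noetherian (Ideal.ofList as)) (hJ.trans hmap'.symm).ge
  have hGprod : ∏ i, G i ∉ p := Submonoid.prod_mem p.primeCompl fun i _ ↦ hG i
  refine ⟨as, g₁ * g₂ * ∏ i, G i,
    p.primeCompl.mul_mem (p.primeCompl.mul_mem hg₁ hg₂) hGprod, fun T' _ _ _ ↦ ?_⟩
  set g := g₁ * g₂ * ∏ i, G i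
  have hunit : IsUnit (algebraMap T T' g) := IsLocalization.Away.algebraMap_isUnit g
  have hmem {I : Ideal T} {h x : T} (hg : h ∣ g) (hx : h * x ∈ I) :
      algebraMap T T' x ∈ I.map (algebraMap T T') := by
    rw [← Ideal.unit_mul_mem_iff_mem _ hunit, ← map_mul]
    obtain ⟨c, hc⟩ := hg
    refine Ideal.mem_map_of_mem _ ?_
    rw [hc, mul_assoc, mul_left_comm]
    exact I.mul_mem_left _ hx
  refine ⟨(isWeaklyRegular_self_iff _).mpr fun i hi y hy ↦ ?_, le_antisymm ?_ ?_⟩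
  · rw [List.length_map] at hi
    rw [← List.map_take, ← Ideal.map_ofList] at hy ⊢
    obtain ⟨x, s, rfl⟩ := IsLocalization.exists_mk'_eq (Submonoid.powers g) y
    rw [List.getElem_map, IsLocalization.mul_mk'_eq_mk'_of_mul,
      IsLocalization.mk'_mem_map_algebraMap_iff] at hy
    obtain ⟨t, ht, htx⟩ := hy
    rw [mul_left_comm] at htx
    have := hmem (h := G ⟨i, hi⟩) (Dvd.dvd.mul_left (Finset.dvd_prod_of_mem G (Finset.mem_univ _)) _)
      (hGx ⟨i, hi⟩ _ htx)
    obtain ⟨m, hm, hmx⟩ :=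
      (IsLocalization.algebraMap_mem_map_algebraMap_iff (Submonoid.powers g) T' _ _).mp this
    rw [IsLocalization.mk'_mem_map_algebraMap_iff]
    exact ⟨m * t, mul_mem hm ht, by rwa [mul_assoc]⟩
  · rw [Ideal.map_le_iff_le_comap, ← Ideal.map_ofList]
    exact fun x hx ↦ hmem (Dvd.intro _ (mul_assoc _ _ _).symm) (hgx₁ x hx)
  · rw [← Ideal.map_ofList, Ideal.map_le_iff_le_comap]
    exact fun x hx ↦ hmem (h := g₂) ⟨g₁ * ∏ i, G i, by simp only [g]; ring⟩ (hgx₂ x hx)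

end RegularSequences

/-! ### The conormal sequence and projective dimension of differentials. -/

section Differentials

open TensorProduct KaehlerDifferential RingTheory.Sequence

lemma RingHom.ker_eq_map_ker_of_isLocalization_atPrime {A B : Type*} [CommRing A] [CommRing B]
    [Algebra A B] (hs : Function.Surjective (algebraMap A B)) (q : Ideal B) [q.IsPrime]
    (A' B' : Type*) [CommRing A'] [CommRing B'] [Algebra A A'] [Algebra B B'] [Algebra A' B']
    [Algebra A B'] [IsScalarTower A B B'] [IsScalarTower A A' B'] [IsLocalization.AtPrime B' q]
    [IsLocalization.AtPrime A' (q.comap (algebraMap A B))] :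
    Function.Surjective (algebraMap A' B') ∧
      RingHom.ker (algebraMap A' B') =
        (RingHom.ker (algebraMap A B)).map (algebraMap A A') := by
  let Q := q.comap (algebraMap A B)
  have hcomp (a : A) : algebraMap A' B' (algebraMap A A' a) = algebraMap B B' (algebraMap A B a) := by
    rw [← IsScalarTower.algebraMap_apply, ← IsScalarTower.algebraMap_apply]
  constructor
  · intro y
    obtain ⟨b, s, rfl⟩ := IsLocalization.exists_mk'_eq q.primeCompl y
    obtain ⟨a, rfl⟩ := hs b
    obtain ⟨t, ht⟩ := hs s
    have htQ : t ∈ Q.primeCompl := fun h ↦ s.2 (ht ▸ h)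
    refine ⟨IsLocalization.mk' A' a (⟨t, htQ⟩ : Q.primeCompl), ?_⟩
    rw [IsLocalization.eq_mk'_iff_mul_eq, ← ht, ← hcomp, ← map_mul]
    rw [IsLocalization.mk'_spec A' a (⟨t, htQ⟩ : Q.primeCompl), hcomp]
  · apply le_antisymm
    · intro z hz
      obtain ⟨a, t, rfl⟩ := IsLocalization.exists_mk'_eq Q.primeCompl z
      have h1 : algebraMap B B' (algebraMap A B a) = 0 := by
        rw [← hcomp, ← IsLocalization.mk'_spec' A' a t, map_mul, RingHom.mem_ker.mp hz, mul_zero]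
      rw [IsLocalization.map_eq_zero_iff q.primeCompl] at h1
      obtain ⟨s, hsa⟩ := h1
      obtain ⟨m, hm⟩ := hs s
      rw [IsLocalization.mk'_mem_map_algebraMap_iff]
      refine ⟨m, fun h ↦ s.2 (hm ▸ h), ?_⟩
      rw [RingHom.mem_ker, map_mul, hm, hsa]
    · rw [Ideal.map_le_iff_le_comap]
      intro x hx
      rw [Ideal.mem_comap, RingHom.mem_ker, hcomp, RingHom.mem_ker.mp hx, map_zero]

/-- If `B = A / I` is formally smooth at a prime `q`, then the kernel of
`I / I ^ 2 → B ⊗ Ω` vanishes at `q`. -/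
lemma exists_notMem_mul_mem_sq_of_tmul_D_eq_zero {R A B : Type*} [CommRing R] [CommRing A]
    [CommRing B] [Algebra R A] [Algebra A B] [Algebra R B] [IsScalarTower R A B]
    [Algebra.FormallySmooth R A] (hs : Function.Surjective (algebraMap A B)) (q : Ideal B)
    [q.IsPrime] [Algebra.FormallySmooth R (Localization.AtPrime q)] {x : A}
    (hx : x ∈ RingHom.ker (algebraMap A B)) (hD : (1 : B) ⊗ₜ[A] D R A x = 0) :
    ∃ s : A, algebraMap A B s ∉ q ∧ s * x ∈ RingHom.ker (algebraMap A B) ^ 2 := by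
  let Q := q.comap (algebraMap A B)
  let A' := Localization.AtPrime Q
  let B' := Localization.AtPrime q
  let g : A' →+* B' := Localization.localRingHom Q q (algebraMap A B) rfl
  algebraize [g]
  have : IsScalarTower A A' B' := IsScalarTower.of_algebraMap_eq fun a ↦ by
    rw [IsScalarTower.algebraMap_apply A B B']
    exact (Localization.localRingHom_to_map Q q (algebraMap A B) rfl a).symm
  have : IsScalarTower R A' B' := IsScalarTower.of_algebraMap_eq fun a ↦ by
    rw [IsScalarTower.algebraMap_apply R A A', ← IsScalarTower.algebraMap_apply A A' B',
      ← IsScalarTower.algebraMap_apply R A B']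
  obtain ⟨hsurj, hker⟩ := RingHom.ker_eq_map_ker_of_isLocalization_atPrime hs q A' B'
  -- Formal smoothness of `B'` makes the conormal map injective at `q`, so `x` lies in the square of
  -- the kernel there; a denominator `s` brings this back to `A`.
  have hinj := (Algebra.FormallySmooth.kerCotangentToTensor_injective_iff (R := R) (P := A')
    (A := B') hsurj).mpr inferInstance
  let t : B ⊗[A] Ω[A⁄R] →ₗ[B] B' ⊗[A'] Ω[A'⁄R] := LinearMap.liftBaseChange B
    ((TensorProduct.mk A' B' Ω[A'⁄R] 1).restrictScalars A ∘ₗ KaehlerDifferential.map R R A A')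
  have ht : t (1 ⊗ₜ D R A x) = 1 ⊗ₜ D R A' (algebraMap A A' x) := by simp [t]
  rw [hD, map_zero] at ht
  have hx' : algebraMap A A' x ∈ RingHom.ker (algebraMap A' B') := by
    rw [hker]; exact Ideal.mem_map_of_mem _ hx
  have h0 : Ideal.toCotangent _ (⟨_, hx'⟩ : RingHom.ker (algebraMap A' B')) = 0 := by
    apply hinj
    rw [map_zero, kerCotangentToTensor_toCotangent]
    exact ht.symm
  replace h0 := (Ideal.toCotangent_eq_zero _ _).mp h0
  change algebraMap A A' x ∈ _ at h0
  rw [hker, ← Ideal.map_pow] at h0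
  obtain ⟨s, hs, hsx⟩ := (IsLocalization.algebraMap_mem_map_algebraMap_iff Q.primeCompl A' _ _).mp h0
  exact ⟨s, hs, hsx⟩

lemma hasProjectiveDimensionLE_one_of_ker_free {B V W : Type u} [CommRing B] [AddCommGroup V]
    [Module B V] [Module.Projective B V] [AddCommGroup W] [Module B W] {p : V →ₗ[B] W}
    (hp : Function.Surjective p) {k : ℕ} (v : Fin k → V) (hv : ∀ i, p (v i) = 0)
    (hli : ∀ b : Fin k → B, ∑ i, b i • v i = 0 → ∀ i, b i = 0)
    (hspan : ∀ z, p z = 0 → ∃ b : Fin k → B, z = ∑ i, b i • v i) :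
    HasProjectiveDimensionLE (ModuleCat.of B W) 1 := by
  rw [show 1 = 0 + 1 from rfl, hasProjectiveDimensionLE_succ_iff_ker hp,
    hasProjectiveDimensionLE_zero_iff_projective]
  let w (i : Fin k) : LinearMap.ker p := ⟨v i, hv i⟩
  have hw (b : Fin k → B) : ((∑ i, b i • w i : LinearMap.ker p) : V) = ∑ i, b i • v i := by
    simp [w]
  refine Module.Projective.of_basis (Module.Basis.mk (v := w) ?_ ?_)
  · rw [Fintype.linearIndependent_iff]
    exact fun b hb ↦ hli b (by rw [← hw, hb]; rfl)
  · rintro ⟨z, hz⟩ -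
    obtain ⟨b, rfl⟩ := hspan z hz
    have : ∑ i, b i • w i ∈ Submodule.span B (Set.range w) :=
      Submodule.sum_mem _ fun i _ ↦ Submodule.smul_mem _ _ (Submodule.subset_span ⟨i, rfl⟩)
    convert this using 1
    exact Subtype.ext (hw b).symm

lemma exists_ker_linearEquiv_of_hasProjectiveDimensionLE_one {B V W : Type u} [CommRing B]
    [IsNoetherianRing B] [IsLocalRing B] [AddCommGroup V] [Module B V] [Module.Projective B V]
    [Module.Finite B V] [AddCommGroup W] [Module B W] {p : V →ₗ[B] W}
    (hp : Function.Surjective p) (h : HasProjectiveDimensionLE (ModuleCat.of B W) 1) :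
    ∃ r : ℕ, Nonempty (LinearMap.ker p ≃ₗ[B] (Fin r → B)) := by
  rw [show 1 = 0 + 1 from rfl, hasProjectiveDimensionLE_succ_iff_ker hp,
    hasProjectiveDimensionLE_zero_iff_projective] at h
  have : Module.Free B (LinearMap.ker p) := Module.free_of_flat_of_isLocalRing
  exact ⟨_, ⟨(Module.finBasis B (LinearMap.ker p)).equivFun⟩⟩

/-- If `B` is the quotient of a formally smooth algebra by a regular sequence and `B` is formally
smooth at its associated primes, then its module of differentials has projective dimension at
most one. -/
theorem hasProjectiveDimensionLE_one_kaehlerDifferential {R A B : Type u} [CommRing R] [CommRing A]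
    [CommRing B] [Algebra R A] [Algebra A B] [Algebra R B] [IsScalarTower R A B]
    [Algebra.FormallySmooth R A] [IsNoetherianRing B] (hs : Function.Surjective (algebraMap A B))
    {rs : List A} (hrs : IsWeaklyRegular A rs)
    (hker : RingHom.ker (algebraMap A B) = Ideal.ofList rs)
    (hsm : ∀ (q : Ideal B) [q.IsPrime], q ∈ associatedPrimes B B →
      Algebra.FormallySmooth R (Localization.AtPrime q)) :
    HasProjectiveDimensionLE (ModuleCat.of B Ω[B⁄R]) 1 := by
  obtain ⟨k, f, hspan, hindep⟩ := exists_span_range_eq_of_isWeaklyRegular hrs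
  rw [← hker] at hspan hindep
  have hp := mapBaseChange_surjective R A B hs
  have hf (i) : f i ∈ RingHom.ker (algebraMap A B) := by
    rw [← hspan]; exact Ideal.subset_span ⟨i, rfl⟩
  let v (i : Fin k) : B ⊗[A] Ω[A⁄R] := 1 ⊗ₜ D R A (f i)
  -- In the Leibniz rule the terms `f i • D (c i)` vanish, because `f i` is zero in `B`.
  have hsum (c : Fin k → A) : (1 : B) ⊗ₜ[A] D R A (∑ i, c i * f i) =
      ∑ i, algebraMap A B (c i) • v i := by
    rw [map_sum, tmul_sum]
    refine Finset.sum_congr rfl fun i _ ↦ ?_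
    rw [Derivation.leibniz, tmul_add, tmul_smul, tmul_smul, algebraMap_smul,
      smul_tmul' (f i), Algebra.smul_def (f i), RingHom.mem_ker.mp (hf i), zero_mul, zero_tmul,
      add_zero]
  refine hasProjectiveDimensionLE_one_of_ker_free hp v ?_ ?_ ?_
  · intro i
    simp [v, RingHom.mem_ker.mp (hf i)]
  · intro b hb i
    choose a ha using fun i ↦ hs (b i)
    obtain rfl : (fun i ↦ algebraMap A B (a i)) = b := funext ha
    have h0 := hsum a
    rw [hb] at h0
    by_contra hne
    -- The annihilator of a nonzero coefficient lies in an associated prime `q`. Independence modulo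
    -- squares yields an element outside `q` killing that coefficient, a contradiction.
    obtain ⟨q, hq, hle⟩ := exists_le_isAssociatedPrime_of_isNoetherianRing B _ hne
    have : q.IsPrime := hq.1
    have := hsm q hq
    obtain ⟨s, hsq, hsx⟩ := exists_notMem_mul_mem_sq_of_tmul_D_eq_zero hs q
      (Ideal.sum_mem _ fun i _ ↦ Ideal.mul_mem_left _ (a i) (hf i)) h0
    have := hindep (fun i ↦ s * a i) (by
      convert hsx using 1
      rw [Finset.mul_sum]
      exact Finset.sum_congr rfl fun i _ ↦ mul_assoc _ _ _) i
    refine hsq (hle ?_)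
    rw [RingHom.mem_ker, map_mul] at this
    simpa [Submodule.mem_colon_singleton] using this
  · intro z hz
    obtain ⟨y, rfl⟩ := (exact_kerCotangentToTensor_mapBaseChange R A B hs z).mp hz
    obtain ⟨⟨x, hx⟩, rfl⟩ := Ideal.toCotangent_surjective _ y
    rw [← hspan] at hx
    obtain ⟨c, rfl⟩ := (Ideal.mem_span_range_iff_exists_fun).mp hx
    exact ⟨_, hsum c⟩

/-- Let `B` be a quotient of a Noetherian local formally smooth `R`-algebra `A`, of finite
projective dimension over `A`. If `B` is formally smooth at its minimal primes and its module of
differentials has projective dimension at most one, then the kernel of `A → B` is generated by a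
regular sequence. -/
theorem exists_isWeaklyRegular_of_hasProjectiveDimensionLE_one {R A B : Type u} [CommRing R]
    [CommRing A] [CommRing B] [Algebra R A] [Algebra A B] [Algebra R B] [IsScalarTower R A B]
    [Algebra.FormallySmooth R A] [Algebra.EssFiniteType R A] [IsNoetherianRing A] [IsLocalRing A]
    [Nontrivial B] (hs : Function.Surjective (algebraMap A B)) {n : ℕ}
    (hpd : HasProjectiveDimensionLE (ModuleCat.of A B) n)
    (hΩ : HasProjectiveDimensionLE (ModuleCat.of B Ω[B⁄R]) 1)
    (hsm : ∀ (q : Ideal B) [q.IsPrime], q ∈ minimalPrimes B →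
      Algebra.FormallySmooth R (Localization.AtPrime q)) :
    ∃ rs : List A, IsWeaklyRegular A rs ∧ RingHom.ker (algebraMap A B) = Ideal.ofList rs := by
  have hp := mapBaseChange_surjective R A B hs
  have : IsLocalRing B := IsLocalRing.of_surjective' _ hs
  have : IsNoetherianRing B := isNoetherianRing_of_surjective A B _ hs
  -- The kernel of `B ⊗ Ω[A⁄R] → Ω[B⁄R]` is free; by conormal exactness `κ` maps the kernel of `A →
  -- B` onto it.
  obtain ⟨r, ⟨e⟩⟩ := exists_ker_linearEquiv_of_hasProjectiveDimensionLE_one hp hΩ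
  let κ : RingHom.ker (algebraMap A B) →ₗ[A] LinearMap.ker (mapBaseChange R A B) :=
    { toFun := fun x ↦ ⟨kerToTensor R A B x, by simp [RingHom.mem_ker.mp x.2]⟩
      map_add' := fun x y ↦ Subtype.ext (map_add (kerToTensor R A B) x y)
      map_smul' := fun a x ↦ Subtype.ext (map_smul (kerToTensor R A B) a x) }
  have hκ : Function.Surjective κ := by
    rintro ⟨z, hz⟩
    obtain ⟨y, rfl⟩ := (exact_kerCotangentToTensor_mapBaseChange R A B hs z).mp hz
    obtain ⟨x, rfl⟩ := Ideal.toCotangent_surjective _ y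
    exact ⟨x, rfl⟩
  refine exists_isWeaklyRegular_ker_eq_ofList n _ A hs hpd (e.toLinearMap.restrictScalars A ∘ₗ κ)
    (e.surjective.comp hκ) fun x hx q hq ↦ ?_
  have : q.IsPrime := hq.1.1
  have := hsm q hq
  refine exists_notMem_mul_mem_sq_of_tmul_D_eq_zero (R := R) hs q x.2 ?_
  have : κ x = 0 := e.injective (by rw [map_zero]; exact hx)
  exact congrArg Subtype.val this

end Differentials

/-! ### Stalks at generizations, and smoothness at primes of a local ring. -/

namespace AlgebraicGeometry

variable {X Y : Scheme.{u}}

/-- Both stalks are localizations of the sections over one affine open containing `x`, hence `ξ`;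
the larger localization factors through the smaller. -/
lemma isLocalization_stalkSpecializes {x ξ : X} (h : ξ ⤳ x) :
    letI := (X.presheaf.stalkSpecializes h).hom.toAlgebra
    IsLocalization.AtPrime (X.presheaf.stalk ξ)
      ((IsLocalRing.maximalIdeal (X.presheaf.stalk ξ)).comap
        (X.presheaf.stalkSpecializes h).hom) := by
  let := (X.presheaf.stalkSpecializes h).hom.toAlgebra
  obtain ⟨U, hU, hxU, -⟩ := exists_isAffineOpen_mem_and_subset (show x ∈ (⊤ : X.Opens) from trivial)
  have hξU : ξ ∈ U := h.mem_open U.isOpen hxU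
  let := X.presheaf.algebra_section_stalk (⟨x, hxU⟩ : U)
  let := X.presheaf.algebra_section_stalk (⟨ξ, hξU⟩ : U)
  have := hU.isLocalization_stalk ⟨x, hxU⟩
  have := hU.isLocalization_stalk ⟨ξ, hξU⟩
  have : IsScalarTower Γ(X, U) (X.presheaf.stalk x) (X.presheaf.stalk ξ) :=
    IsScalarTower.of_algebraMap_eq' <| by
      simp only [RingHom.algebraMap_toAlgebra]
      rw [← CommRingCat.hom_comp, TopCat.Presheaf.germ_stalkSpecializes]
  have hle : (hU.primeIdealOf ⟨x, hxU⟩).asIdeal.primeCompl ≤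
      (hU.primeIdealOf ⟨ξ, hξU⟩).asIdeal.primeCompl := by
    intro s hs
    have h1 := IsLocalization.map_units (X.presheaf.stalk x)
      (⟨s, hs⟩ : (hU.primeIdealOf ⟨x, hxU⟩).asIdeal.primeCompl)
    have h2 := h1.map (algebraMap (X.presheaf.stalk x) (X.presheaf.stalk ξ))
    rw [← IsScalarTower.algebraMap_apply] at h2
    exact (IsLocalization.AtPrime.isUnit_to_map_iff (X.presheaf.stalk ξ)
      (hU.primeIdealOf ⟨ξ, hξU⟩).asIdeal s).mp h2
  have := IsLocalization.isLocalization_of_submonoid_le (X.presheaf.stalk x)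
    (X.presheaf.stalk ξ) _ _ hle
  refine IsLocalization.of_le (M := Submonoid.map
    (algebraMap Γ(X, U) (X.presheaf.stalk x)) (hU.primeIdealOf ⟨ξ, hξU⟩).asIdeal.primeCompl) _ ?_ ?_
  · intro s hs hs'
    exact hs' (IsLocalization.map_units (X.presheaf.stalk ξ) (⟨s, hs⟩ : Submonoid.map
      (algebraMap Γ(X, U) (X.presheaf.stalk x)) (hU.primeIdealOf ⟨ξ, hξU⟩).asIdeal.primeCompl))
  · intro s hs
    by_contra hn
    exact hs hn

lemma exists_isLocalization_stalkSpecializes (x : X) (q : Ideal (X.presheaf.stalk x))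
    [q.IsPrime] : ∃ (ξ : X) (h : ξ ⤳ x),
      letI := (X.presheaf.stalkSpecializes h).hom.toAlgebra
      IsLocalization.AtPrime (X.presheaf.stalk ξ) q := by
  obtain ⟨y, hy⟩ : ∃ y : Spec (X.presheaf.stalk x), y.asIdeal = q := ⟨⟨q, inferInstance⟩, rfl⟩
  have h : X.fromSpecStalk x y ⤳ x := by
    have : X.fromSpecStalk x y ∈ Set.range (X.fromSpecStalk x) := ⟨y, rfl⟩
    rwa [Scheme.range_fromSpecStalk] at this
  refine ⟨X.fromSpecStalk x y, h, ?_⟩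
  -- Both points have the same image in `X`, and `Spec` of a stalk embeds in `X`.
  have key : Spec.map (X.presheaf.stalkSpecializes h) (IsLocalRing.closedPoint _) = y := by
    apply (X.fromSpecStalk x).isEmbedding.injective
    refine (Scheme.Hom.comp_apply _ _ _).symm.trans ?_
    rw [Scheme.SpecMap_stalkSpecializes_fromSpecStalk]
    exact Scheme.fromSpecStalk_closedPoint
  have := isLocalization_stalkSpecializes h
  have hq : (IsLocalRing.maximalIdeal (X.presheaf.stalk (X.fromSpecStalk x y))).comap
        (X.presheaf.stalkSpecializes h).hom = q := hy ▸ congr($(key).asIdeal)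
  convert this
  exact hq.symm

end AlgebraicGeometry

namespace DiffCI

variable {X Y : Scheme.{u}}

lemma IsSmoothAt.formallySmooth_stalkMap {f : X ⟶ Y} {ξ : X} (h : IsSmoothAt f ξ) :
    (f.stalkMap ξ).hom.FormallySmooth := by
  obtain ⟨U, hξ, hU⟩ := h
  obtain ⟨y, rfl⟩ : ∃ y : U.toScheme, U.ι y = ξ := ⟨⟨ξ, hξ⟩, rfl⟩
  have h1 : ((U.ι ≫ f).stalkMap y).hom.FormallySmooth := by
    rw [← Scheme.Hom.mem_smoothLocus, Scheme.Hom.smoothLocus_eq_top]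
    trivial
  rw [Scheme.Hom.stalkMap_comp] at h1
  exact (RingHom.FormallySmooth.respectsIso.cancel_right_isIso _ _).mp h1

/-- Smoothness at `ξ` concerns the base ring at `f ξ`; that ring is a localization of the one at `f
x`, hence formally smooth over it. -/
lemma IsSmoothAt.formallySmooth_stalkSpecializes {f : X ⟶ Y} {x ξ : X} (h : IsSmoothAt f ξ)
    (hx : ξ ⤳ x) :
    ((X.presheaf.stalkSpecializes hx).hom.comp (f.stalkMap x).hom).FormallySmooth := by
  rw [← CommRingCat.hom_comp, ← Scheme.Hom.stalkSpecializes_stalkMap, CommRingCat.hom_comp]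
  refine RingHom.FormallySmooth.comp ?_ h.formallySmooth_stalkMap
  let := (Y.presheaf.stalkSpecializes (hx.map f.continuous)).hom.toAlgebra
  have := isLocalization_stalkSpecializes (hx.map f.continuous)
  rw [RingHom.FormallySmooth]
  exact Algebra.FormallySmooth.of_isLocalization ((IsLocalRing.maximalIdeal (Y.presheaf.stalk (f ξ))).comap
        (Y.presheaf.stalkSpecializes (hx.map f.continuous)).hom).primeCompl

/-- If `f` is smooth at the point corresponding to a prime `q` of a local ring of `X`, then the
localization at `q` is formally smooth. -/
lemma formallySmooth_localization_atPrime {f : X ⟶ Y} {x : X} (q : Ideal (X.presheaf.stalk x))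
    [q.IsPrime] (P : X → Prop) (hf : ∀ ξ, P ξ → IsSmoothAt f ξ)
    (hP : ∀ (ξ : X) [Algebra (X.presheaf.stalk x) (X.presheaf.stalk ξ)]
      [IsLocalization.AtPrime (X.presheaf.stalk ξ) q], P ξ) :
    letI := (f.stalkMap x).hom.toAlgebra
    Algebra.FormallySmooth (Y.presheaf.stalk (f x)) (Localization.AtPrime q) := by
  obtain ⟨ξ, h, hloc⟩ := exists_isLocalization_stalkSpecializes x q
  let := (X.presheaf.stalkSpecializes h).hom.toAlgebra
  let := (f.stalkMap x).hom.toAlgebra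
  let := ((X.presheaf.stalkSpecializes h).hom.comp (f.stalkMap x).hom).toAlgebra
  have : IsScalarTower (Y.presheaf.stalk (f x)) (X.presheaf.stalk x) (X.presheaf.stalk ξ) :=
    IsScalarTower.of_algebraMap_eq' rfl
  have : Algebra.FormallySmooth (Y.presheaf.stalk (f x)) (X.presheaf.stalk ξ) :=
    (hf ξ (hP ξ)).formallySmooth_stalkSpecializes h
  exact Algebra.FormallySmooth.of_equiv
    ((IsLocalization.algEquiv q.primeCompl (X.presheaf.stalk ξ)
      (Localization.AtPrime q)).restrictScalars (Y.presheaf.stalk (f x)))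

lemma formallySmooth_localization_of_mem_associatedPrimes {f : X ⟶ Y} {x : X}
    (hf : ∀ ξ : X, IsAssociatedPoint ξ → IsSmoothAt f ξ) (q : Ideal (X.presheaf.stalk x))
    [q.IsPrime] (hq : q ∈ associatedPrimes (X.presheaf.stalk x) (X.presheaf.stalk x)) :
    letI := (f.stalkMap x).hom.toAlgebra
    Algebra.FormallySmooth (Y.presheaf.stalk (f x)) (Localization.AtPrime q) := by
  refine formallySmooth_localization_atPrime q _ hf fun ξ _ _ ↦ ?_
  apply Module.associatedPrimes.mem_associatedPrimes_of_comap_mem_associatedPrimes_of_isLocalizedModule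
    q.primeCompl (M := X.presheaf.stalk x) (f := Algebra.linearMap _ _)
  convert hq
  exact IsLocalization.AtPrime.under_maximalIdeal (X.presheaf.stalk ξ) q

lemma formallySmooth_localization_of_mem_minimalPrimes {f : X ⟶ Y} {x : X}
    (hf : IsGenericallySmooth f) (q : Ideal (X.presheaf.stalk x))
    [q.IsPrime] (hq : q ∈ minimalPrimes (X.presheaf.stalk x)) :
    letI := (f.stalkMap x).hom.toAlgebra
    Algebra.FormallySmooth (Y.presheaf.stalk (f x)) (Localization.AtPrime q) := by
  refine formallySmooth_localization_atPrime q _ hf fun ξ _ _ ↦ ?_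
  rw [IsMaximalPoint, IsLocalization.AtPrime.ringKrullDim_eq_height q,
    Ideal.height_eq_zero_iff.mpr hq]
  rfl

end DiffCI

/-! ### From l.c.i. to d.c.i. -/

namespace DiffCI

variable {X Y : Scheme.{u}}

lemma IsRegularImmersion.exists_isWeaklyRegular_stalkMap {i : X ⟶ Y} (hi : IsRegularImmersion i)
    (x : X) : Function.Surjective (i.stalkMap x).hom ∧ ∃ rs : List (Y.presheaf.stalk (i x)),
      RingTheory.Sequence.IsWeaklyRegular (Y.presheaf.stalk (i x)) rs ∧
        RingHom.ker (i.stalkMap x).hom = Ideal.ofList rs := by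
  have := hi.isClosedImmersion
  obtain ⟨⟨W, hW⟩, hxW, rs, hrs, hker⟩ := hi.exists_isRegular x
  have hV : IsAffineOpen (i ⁻¹ᵁ W) := hW.preimage i
  have hxV : x ∈ i ⁻¹ᵁ W := hxW
  let := (i.app W).hom.toAlgebra
  let := Y.presheaf.algebra_section_stalk (⟨i x, hxW⟩ : W)
  let := X.presheaf.algebra_section_stalk (⟨x, hxV⟩ : (i ⁻¹ᵁ W : X.Opens))
  have hlocY := hW.isLocalization_stalk ⟨i x, hxW⟩
  have hlocX := hV.isLocalization_stalk ⟨x, hxV⟩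
  let := (i.stalkMap x).hom.toAlgebra
  let := ((X.presheaf.germ (i ⁻¹ᵁ W) x hxV).hom.comp (i.app W).hom).toAlgebra
  have : IsScalarTower Γ(Y, W) Γ(X, i ⁻¹ᵁ W) (X.presheaf.stalk x) :=
    IsScalarTower.of_algebraMap_eq' rfl
  have : IsScalarTower Γ(Y, W) (Y.presheaf.stalk (i x)) (X.presheaf.stalk x) :=
    IsScalarTower.of_algebraMap_eq' <| by
      simp only [RingHom.algebraMap_toAlgebra]
      rw [← CommRingCat.hom_comp, ← CommRingCat.hom_comp, Scheme.Hom.germ_stalkMap]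
  have hcomap : (hV.primeIdealOf ⟨x, hxV⟩).asIdeal.comap (algebraMap Γ(Y, W) Γ(X, i ⁻¹ᵁ W)) =
      (hW.primeIdealOf ⟨i x, hxW⟩).asIdeal := by
    have := IsAffineOpen.comap_primeIdealOf_appLE (f := i) W hW _ hV le_rfl hxV
    rw [← Scheme.Hom.app_eq_appLE] at this
    exact congr($(this).asIdeal)
  have : IsLocalization.AtPrime (Y.presheaf.stalk (i x))
      ((hV.primeIdealOf ⟨x, hxV⟩).asIdeal.comap (algebraMap Γ(Y, W) Γ(X, i ⁻¹ᵁ W))) := by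
    convert hlocY
  obtain ⟨hs, hk⟩ := RingHom.ker_eq_map_ker_of_isLocalization_atPrime
    (A := Γ(Y, W)) (B := Γ(X, i ⁻¹ᵁ W)) (i.app_surjective W hW)
    (hV.primeIdealOf ⟨x, hxV⟩).asIdeal (Y.presheaf.stalk (i x)) (X.presheaf.stalk x)
  refine ⟨hs, rs.map (algebraMap _ _), hrs.toIsWeaklyRegular.of_isLocalization _
    (hW.primeIdealOf ⟨i x, hxW⟩).asIdeal.primeCompl, ?_⟩
  refine hk.trans ?_
  rw [← Ideal.map_ofList, ← hker]
  rfl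

theorem IsLCIAt.isDCIAt {f : X ⟶ Y} [IsLocallyNoetherian X] {x : X}
    (hf : ∀ ξ : X, IsAssociatedPoint ξ → IsSmoothAt f ξ) (h : IsLCIAt f x) : IsDCIAt f x := by
  obtain ⟨U, hxU, Z, i, p, hi, hp, hip⟩ := h
  obtain ⟨y, rfl⟩ : ∃ y : U.toScheme, U.ι y = x := ⟨⟨x, hxU⟩, rfl⟩
  obtain ⟨hs, rs, hrs, hker⟩ := hi.exists_isWeaklyRegular_stalkMap y
  have hpt : p (i y) = f (U.ι y) := by
    rw [← Scheme.Hom.comp_apply, hip, Scheme.Hom.comp_apply]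
  -- The two base points are equal only propositionally, so their stalks are identified through an
  -- isomorphism.
  let e : Y.presheaf.stalk (f (U.ι y)) ⟶ Y.presheaf.stalk (p (i y)) :=
    Y.presheaf.stalkSpecializes (specializes_of_eq hpt)
  have : IsIso e := (Y.presheaf.stalkCongr (Inseparable.of_eq hpt.symm)).isIso_hom
  let a : Y.presheaf.stalk (f (U.ι y)) ⟶ Z.presheaf.stalk (i y) := e ≫ p.stalkMap (i y)
  let b : Z.presheaf.stalk (i y) ⟶ X.presheaf.stalk (U.ι y) :=
    i.stalkMap y ≫ inv (U.ι.stalkMap y)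
  have hab : a ≫ b = f.stalkMap (U.ι y) := by
    rw [← cancel_mono (U.ι.stalkMap y)]
    have h1 : f.stalkMap (U.ι y) ≫ U.ι.stalkMap y = e ≫ p.stalkMap (i y) ≫ i.stalkMap y :=
      ((Scheme.Hom.stalkMap_comp U.ι f y).symm.trans
        (Scheme.Hom.stalkMap_congr_hom _ _ hip.symm y)).trans
        (congrArg (e ≫ ·) (Scheme.Hom.stalkMap_comp i p y))
    simp [a, b, h1]
  have ha : a.hom.FormallySmooth := by
    refine (RingHom.FormallySmooth.respectsIso.cancel_left_isIso e _).mpr ?_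
    rw [← Scheme.Hom.mem_smoothLocus, Scheme.Hom.smoothLocus_eq_top]
    trivial
  let := a.hom.toAlgebra
  let := b.hom.toAlgebra
  let := (f.stalkMap (U.ι y)).hom.toAlgebra
  have : IsScalarTower (Y.presheaf.stalk (f (U.ι y))) (Z.presheaf.stalk (i y))
      (X.presheaf.stalk (U.ι y)) :=
    IsScalarTower.of_algebraMap_eq' congr($(hab.symm).hom)
  have : Algebra.FormallySmooth (Y.presheaf.stalk (f (U.ι y))) (Z.presheaf.stalk (i y)) := ha
  have hb : Function.Surjective b.hom :=
    (ConcreteCategory.bijective_of_isIso (inv (U.ι.stalkMap y))).surjective.comp hs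
  have hkb : RingHom.ker b.hom = RingHom.ker (i.stalkMap y).hom :=
    RingHom.ker_comp_of_injective _
      (ConcreteCategory.bijective_of_isIso (inv (U.ι.stalkMap y))).injective
  have := hasProjectiveDimensionLE_one_kaehlerDifferential
    (R := Y.presheaf.stalk (f (U.ι y))) (A := Z.presheaf.stalk (i y))
    (B := X.presheaf.stalk (U.ι y)) hb hrs (hkb.trans hker)
    fun q _ hq ↦ formallySmooth_localization_of_mem_associatedPrimes hf q hq
  exact (projectiveDimension_le_iff _ 1).mpr this

end DiffCI

/-! ### From d.c.i. to l.c.i. -/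

/-- Let `T → C` be surjective, let `B` be a local ring of `C` and let `S` be a localization of `T`
that is formally smooth over `R` and maps to `B`. If `B` has finite projective dimension over `S`
and `Ω[B⁄R]` has projective dimension at most `1`, then the kernel of `T → C` is generated by
a weakly regular sequence after inverting a single element outside the chosen prime. -/
lemma exists_notMem_isWeaklyRegular_ker {R S T B C : Type u} [CommRing R] [CommRing S]
    [CommRing T] [CommRing B] [CommRing C] [Algebra R S] [Algebra T S] [Algebra S B] [Algebra T C]
    [Algebra C B] [Algebra R B] [Algebra T B] [IsScalarTower R S B] [IsScalarTower T S B]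
    [IsScalarTower T C B] [IsNoetherianRing T] [Algebra.FormallySmooth R S]
    [Algebra.EssFiniteType R S] (hs : Function.Surjective (algebraMap T C)) (M : Submonoid T)
    [IsLocalization M S] (q : Ideal C) [q.IsPrime] [IsLocalization.AtPrime B q] {d : ℕ}
    (hpd : HasProjectiveDimensionLE (ModuleCat.of S B) d)
    (hΩ : HasProjectiveDimensionLE (ModuleCat.of B Ω[B⁄R]) 1)
    (hsm : ∀ (q : Ideal B) [q.IsPrime], q ∈ minimalPrimes B →
      Algebra.FormallySmooth R (Localization.AtPrime q)) :
    ∃ (as : List T) (g : T), algebraMap T C g ∉ q ∧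
      ∀ (T' : Type u) [CommRing T'] [Algebra T T'] [IsLocalization.Away g T'],
        RingTheory.Sequence.IsWeaklyRegular T' (as.map (algebraMap T T')) ∧
          (RingHom.ker (algebraMap T C)).map (algebraMap T T') =
            Ideal.ofList (as.map (algebraMap T T')) := by
  have : IsLocalRing B := IsLocalization.AtPrime.isLocalRing B q
  have : IsNoetherianRing S := IsLocalization.isNoetherianRing M S inferInstance
  -- The local ring `A` at `Q` plays two roles: over `S` it inherits finite projective dimension,
  -- and over `T` it is the local ring from which the sequence spreads out.
  let Q : Ideal S := (IsLocalRing.maximalIdeal B).comap (algebraMap S B)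
  let A := Localization.AtPrime Q
  let l : A →+* B := IsLocalization.lift (M := Q.primeCompl) (S := A) (g := algebraMap S B)
    fun y ↦ by
      by_contra h
      exact y.2 h
  have hl : l.comp (algebraMap S A) = algebraMap S B := IsLocalization.lift_comp _
  let : Algebra A B := l.toAlgebra
  have : IsScalarTower S A B := IsScalarTower.of_algebraMap_eq' hl.symm
  have : IsScalarTower R A B := IsScalarTower.of_algebraMap_eq fun r ↦ by
    rw [IsScalarTower.algebraMap_apply R S A, ← IsScalarTower.algebraMap_apply S A B,
      ← IsScalarTower.algebraMap_apply R S B]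
  have : IsScalarTower T A B := IsScalarTower.of_algebraMap_eq fun r ↦ by
    rw [IsScalarTower.algebraMap_apply T S A, ← IsScalarTower.algebraMap_apply S A B,
      ← IsScalarTower.algebraMap_apply T S B]
  have hQ : Q.comap (algebraMap T S) = q.comap (algebraMap T C) := by
    rw [← IsLocalization.AtPrime.under_maximalIdeal B q]
    simp only [Q, Ideal.under, Ideal.comap_comap]
    rw [← IsScalarTower.algebraMap_eq, ← IsScalarTower.algebraMap_eq]
  have hA : IsLocalization.AtPrime A (Q.comap (algebraMap T S)) :=
    IsLocalization.isLocalization_isLocalization_atPrime_isLocalization M A Q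
  have : IsLocalization.AtPrime A (q.comap (algebraMap T C)) := by
    convert hA
    exact hQ.symm
  obtain ⟨hsA, hker⟩ := RingHom.ker_eq_map_ker_of_isLocalization_atPrime hs q A B
  have : Algebra.FormallySmooth S A := Algebra.FormallySmooth.of_isLocalization Q.primeCompl
  have : Algebra.FormallySmooth R A := Algebra.FormallySmooth.comp R S A
  have : Algebra.EssFiniteType S A := Algebra.EssFiniteType.of_isLocalization A Q.primeCompl
  have : Algebra.EssFiniteType R A := Algebra.EssFiniteType.comp R S A
  have : IsNoetherianRing A := IsLocalization.isNoetherianRing Q.primeCompl A inferInstance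
  have hpdA := hasProjectiveDimensionLE_of_isLocalization Q.primeCompl (A' := A) _ hpd
  obtain ⟨rs, hrs, hrsk⟩ :=
    exists_isWeaklyRegular_of_hasProjectiveDimensionLE_one hsA hpdA hΩ hsm
  obtain ⟨as, g, hg, h⟩ := exists_notMem_isWeaklyRegular_of_isLocalization_atPrime
    (q.comap (algebraMap T C)) (RingHom.ker (algebraMap T C)) hrs (hker.symm.trans hrsk)
  exact ⟨as, g, hg, fun T' _ _ _ ↦ h T'⟩

/-- A presentation of a finite type algebra whose kernel is, locally at a given prime, generated
by a weakly regular sequence. -/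
lemma exists_mvPolynomial_isWeaklyRegular {R₀ C R B : Type u} [CommRing R₀] [CommRing C]
    [CommRing R] [CommRing B] [Algebra R₀ C] [Algebra R₀ R] [Algebra C B] [Algebra R B]
    [Algebra R₀ B] [IsScalarTower R₀ C B] [IsScalarTower R₀ R B] [Algebra.FiniteType R₀ C]
    [IsNoetherianRing R₀] (M : Submonoid R₀) [IsLocalization M R] (q : Ideal C) [q.IsPrime]
    [IsLocalization.AtPrime B q] {d : ℕ} (hpd : HasProjectiveDimensionLE (ModuleCat.of R B) d)
    (hΩ : HasProjectiveDimensionLE (ModuleCat.of B Ω[B⁄R]) 1)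
    (hsm : ∀ (q : Ideal B) [q.IsPrime], q ∈ minimalPrimes B →
      Algebra.FormallySmooth R (Localization.AtPrime q)) :
    ∃ (n : ℕ) (φ : MvPolynomial (Fin n) R₀ →ₐ[R₀] C) (as : List (MvPolynomial (Fin n) R₀))
      (g : MvPolynomial (Fin n) R₀), Function.Surjective φ ∧ φ g ∉ q ∧
        ∀ (T : Type u) [CommRing T] [Algebra (MvPolynomial (Fin n) R₀) T]
          [IsLocalization.Away g T],
          RingTheory.Sequence.IsWeaklyRegular T (as.map (algebraMap _ T)) ∧
            (RingHom.ker φ).map (algebraMap _ T) = Ideal.ofList (as.map (algebraMap _ T)) := by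
  obtain ⟨n, φ, hφ⟩ := Algebra.FiniteType.iff_quotient_mvPolynomial''.mp
    (inferInstance : Algebra.FiniteType R₀ C)
  let ψ : MvPolynomial (Fin n) R →ₐ[R] B :=
    MvPolynomial.aeval fun i ↦ algebraMap C B (φ (MvPolynomial.X i))
  have hψ : ψ.toRingHom.comp (MvPolynomial.map (algebraMap R₀ R)) =
      (algebraMap C B).comp φ.toRingHom := by
    refine MvPolynomial.ringHom_ext (fun r ↦ ?_) fun i ↦ ?_
    · simp [MvPolynomial.algHom_C, ← IsScalarTower.algebraMap_apply]
    · simp [ψ]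
  let : Algebra (MvPolynomial (Fin n) R₀) C := φ.toRingHom.toAlgebra
  let : Algebra (MvPolynomial (Fin n) R) B := ψ.toRingHom.toAlgebra
  let : Algebra (MvPolynomial (Fin n) R₀) (MvPolynomial (Fin n) R) :=
    MvPolynomial.algebraMvPolynomial
  let : Algebra (MvPolynomial (Fin n) R₀) B := ((algebraMap C B).comp φ.toRingHom).toAlgebra
  have : IsScalarTower (MvPolynomial (Fin n) R₀) C B := IsScalarTower.of_algebraMap_eq' rfl
  have : IsScalarTower R (MvPolynomial (Fin n) R) B :=
    IsScalarTower.of_algebraMap_eq' ψ.comp_algebraMap.symm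
  have : IsScalarTower (MvPolynomial (Fin n) R₀) (MvPolynomial (Fin n) R) B :=
    IsScalarTower.of_algebraMap_eq' hψ.symm
  -- Polynomials over the localization `R` are the localization of polynomials over `R₀` at the
  -- constants from `M`; the `n` variables raise the dimension bound to `d + n`.
  obtain ⟨as, g, hg, h⟩ := exists_notMem_isWeaklyRegular_ker (R := R)
    (S := MvPolynomial (Fin n) R) (B := B) hφ
    (M.map (MvPolynomial.C : R₀ →+* MvPolynomial (Fin n) R₀)) q
    (MvPolynomial.hasProjectiveDimensionLE_add d n B hpd) hΩ hsm
  exact ⟨n, φ, as, g, hφ, hg, fun T _ _ _ ↦ h T⟩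

lemma IsLocalization.Away.map_surjective_and_ker {T C : Type*} [CommRing T] [CommRing C]
    {φ : T →+* C} (hφ : Function.Surjective φ) (g : T) (T' C' : Type*) [CommRing T']
    [CommRing C'] [Algebra T T'] [Algebra C C'] [IsLocalization.Away g T']
    [IsLocalization.Away (φ g) C'] :
    Function.Surjective (IsLocalization.Away.map T' C' φ g) ∧
      RingHom.ker (IsLocalization.Away.map T' C' φ g) = (RingHom.ker φ).map (algebraMap T T') := by
  have h : (Submonoid.powers g).map φ = Submonoid.powers (φ g) := Submonoid.map_powers _ _
  have : IsLocalization ((Submonoid.powers g).map φ) C' := h ▸ inferInstance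
  exact ⟨IsLocalization.map_surjective_of_surjective (Submonoid.powers g) T' C' hφ,
    IsLocalization.ker_map C' φ h⟩

namespace DiffCI

variable {X Y : Scheme.{u}}

lemma isRegularImmersion_isoSpec_hom_comp {U : X.Opens} (hU : IsAffineOpen U) [Nonempty U]
    {A : CommRingCat.{u}} (ρ : A ⟶ Γ(X, U)) (hρ : Function.Surjective ρ.hom) {rs : List A}
    (hrs : RingTheory.Sequence.IsWeaklyRegular A rs) (hker : RingHom.ker ρ.hom = Ideal.ofList rs) :
    IsRegularImmersion (hU.isoSpec.hom ≫ Spec.map ρ) := by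
  have : IsClosedImmersion (Spec.map ρ) := IsClosedImmersion.spec_of_surjective ρ hρ
  refine ⟨inferInstance, fun x ↦ ⟨⟨⊤, isAffineOpen_top _⟩, trivial,
    rs.map (Scheme.ΓSpecIso A).inv.hom, ?_⟩⟩
  have hk : RingHom.ker ((hU.isoSpec.hom ≫ Spec.map ρ).app ⊤).hom =
      Ideal.ofList (rs.map (Scheme.ΓSpecIso A).inv.hom) := by
    have h1 : (Scheme.ΓSpecIso A).inv ≫ (hU.isoSpec.hom ≫ Spec.map ρ).app ⊤ =
        ρ ≫ U.topIso.inv := by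
      have h2 : (Scheme.ΓSpecIso _).inv ≫ hU.isoSpec.hom.appTop = U.topIso.inv := by
        rw [hU.isoSpec_hom_appTop, Iso.inv_hom_id_assoc]
      rw [← h2, Scheme.ΓSpecIso_inv_naturality_assoc]
      rfl
    have h2 : RingHom.ker ρ.hom = (RingHom.ker ((hU.isoSpec.hom ≫ Spec.map ρ).app ⊤).hom).comap
        (Scheme.ΓSpecIso A).inv.hom := by
      rw [RingHom.comap_ker, ← CommRingCat.hom_comp, h1]
      exact (RingHom.ker_comp_of_injective _ (ConcreteCategory.bijective_of_isIso
        U.topIso.inv).injective).symm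
    rw [← Ideal.map_ofList, ← hker, h2, Ideal.map_comap_of_surjective]
    exact (ConcreteCategory.bijective_of_isIso (Scheme.ΓSpecIso A).inv).surjective
  refine ⟨⟨?_, ?_⟩, hk⟩
  · let := (Scheme.ΓSpecIso A).inv.hom.toAlgebra
    have : Module.Flat A Γ(Spec A, ⊤) := RingHom.Flat.of_bijective
      (ConcreteCategory.bijective_of_isIso (Scheme.ΓSpecIso A).inv)
    exact hrs.of_flat
  -- Regular, not merely weakly regular: the ideal is proper because the source is nonempty.
  · rw [← hk, smul_eq_mul, Ideal.mul_top]
    have : Nonempty ((hU.isoSpec.hom ≫ Spec.map ρ) ⁻¹ᵁ ⊤ : U.toScheme.Opens) := ⟨⟨x, trivial⟩⟩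
    exact (RingHom.ker_ne_top _).symm

theorem IsDCIAt.isLCIAt {f : X ⟶ Y} [IsLocallyNoetherian Y] [LocallyOfFiniteType f] {x : X}
    (hf : IsGenericallySmooth f) (hpd : projectiveDimension (stalkModule f x) < ⊤)
    (h : IsDCIAt f x) : IsLCIAt f x := by
  obtain ⟨V, hV, hxV, -⟩ := exists_isAffineOpen_mem_and_subset (show f x ∈ (⊤ : Y.Opens) from trivial)
  obtain ⟨U, hU, hxU, hUV⟩ := exists_isAffineOpen_mem_and_subset (show x ∈ f ⁻¹ᵁ V from hxV)
  obtain ⟨d, hd⟩ := (projectiveDimension_ne_top_iff _).mp hpd.ne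
  let := (f.appLE V U hUV).hom.toAlgebra
  let := Y.presheaf.algebra_section_stalk (⟨f x, hxV⟩ : V)
  let := X.presheaf.algebra_section_stalk (⟨x, hxU⟩ : U)
  have hlocY := hV.isLocalization_stalk ⟨f x, hxV⟩
  have hlocX := hU.isLocalization_stalk ⟨x, hxU⟩
  let := (f.stalkMap x).hom.toAlgebra
  let := ((X.presheaf.germ U x hxU).hom.comp (f.appLE V U hUV).hom).toAlgebra
  have : IsScalarTower Γ(Y, V) Γ(X, U) (X.presheaf.stalk x) :=
    IsScalarTower.of_algebraMap_eq' rfl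
  have : IsScalarTower Γ(Y, V) (Y.presheaf.stalk (f x)) (X.presheaf.stalk x) :=
    IsScalarTower.of_algebraMap_eq' <| by
      simp only [RingHom.algebraMap_toAlgebra]
      rw [← CommRingCat.hom_comp, ← CommRingCat.hom_comp, Scheme.Hom.germ_stalkMap]
      simp [Scheme.Hom.appLE]
  have : Algebra.FiniteType Γ(Y, V) Γ(X, U) := f.finiteType_appLE hV hU hUV
  have : IsNoetherianRing Γ(Y, V) := IsLocallyNoetherian.component_noetherian ⟨V, hV⟩
  obtain ⟨n, φ, as, g, hφ, hg, hT⟩ := exists_mvPolynomial_isWeaklyRegular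
    (R₀ := Γ(Y, V)) (C := Γ(X, U)) (R := Y.presheaf.stalk (f x)) (B := X.presheaf.stalk x)
    (hV.primeIdealOf ⟨f x, hxV⟩).asIdeal.primeCompl (hU.primeIdealOf ⟨x, hxU⟩).asIdeal hd
    ((projectiveDimension_le_iff _ 1).mp h)
    fun q _ hq ↦ formallySmooth_localization_of_mem_minimalPrimes hf q hq
  let T := Localization.Away g
  obtain ⟨hreg, hker⟩ := hT T
  -- Inverting `g` shrinks the neighbourhood to `U'`, which embeds in the smooth `Y`-scheme `Spec T`
  -- with regular ideal.
  let U' : X.Opens := X.basicOpen (φ g)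
  have hU' : IsAffineOpen U' := hU.basicOpen _
  have hle : U' ≤ U := X.basicOpen_le _
  have hxU' : x ∈ U' := by
    rw [Scheme.mem_basicOpen _ _ _ hxU]
    exact (IsLocalization.AtPrime.isUnit_to_map_iff (X.presheaf.stalk x)
      (hU.primeIdealOf ⟨x, hxU⟩).asIdeal (φ g)).mpr hg
  have : Nonempty U' := ⟨⟨x, hxU'⟩⟩
  have : IsLocalization.Away (φ g) Γ(X, U') := hU.isLocalization_basicOpen (φ g)
  obtain ⟨hs, hk⟩ := IsLocalization.Away.map_surjective_and_ker (φ := φ.toRingHom) hφ g T Γ(X, U')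
  let ρ : CommRingCat.of T ⟶ Γ(X, U') :=
    CommRingCat.ofHom (IsLocalization.Away.map T Γ(X, U') φ.toRingHom g)
  have hρ : CommRingCat.ofHom (algebraMap Γ(Y, V) T) ≫ ρ = f.appLE V U' (hle.trans hUV) := by
    rw [← f.appLE_map hUV (homOfLE hle).op]
    ext r
    change IsLocalization.Away.map T Γ(X, U') φ.toRingHom g (algebraMap Γ(Y, V) T r) =
      algebraMap Γ(X, U) Γ(X, U') (algebraMap Γ(Y, V) Γ(X, U) r)
    rw [IsScalarTower.algebraMap_apply Γ(Y, V) (MvPolynomial (Fin n) Γ(Y, V)) T,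
      IsLocalization.Away.map, IsLocalization.map_eq]
    exact congrArg _ (φ.commutes r)
  have : Algebra.Smooth Γ(Y, V) T := by
    have : Algebra.Smooth Γ(Y, V) (MvPolynomial (Fin n) Γ(Y, V)) := ⟨inferInstance, inferInstance⟩
    have := Algebra.Smooth.of_isLocalization_Away (A := T) g
    exact Algebra.Smooth.comp Γ(Y, V) (MvPolynomial (Fin n) Γ(Y, V)) T
  have : Smooth (Spec.map (CommRingCat.ofHom (algebraMap Γ(Y, V) T))) :=
    (HasRingHomProperty.Spec_iff (P := @Smooth)).mpr
      (RingHom.smooth_algebraMap.mpr inferInstance)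
  refine ⟨U', hxU', Spec (.of T), hU'.isoSpec.hom ≫ Spec.map ρ,
    Spec.map (CommRingCat.ofHom (algebraMap Γ(Y, V) T)) ≫ hV.fromSpec,
    isRegularImmersion_isoSpec_hom_comp hU' ρ hs hreg (hk.trans hker), inferInstance, ?_⟩
  rw [Category.assoc, ← Spec.map_comp_assoc, hρ, IsAffineOpen.SpecMap_appLE_fromSpec _ hV hU',
    IsAffineOpen.isoSpec_hom_fromSpec_assoc]

end DiffCI

theorem theorem2p1 {X Y : Scheme.{u}} (π : X ⟶ Y) [IsLocallyNoetherian Y]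
    [LocallyOfFiniteType π] (x : X) :
    ((∀ ξ : X, DiffCI.IsAssociatedPoint ξ → DiffCI.IsSmoothAt π ξ) →
      DiffCI.IsLCIAt π x → DiffCI.IsDCIAt π x) ∧
    (DiffCI.IsGenericallySmooth π →
      projectiveDimension (DiffCI.stalkModule π x) < ⊤ →
      DiffCI.IsDCIAt π x → DiffCI.IsLCIAt π x) := by
  have := LocallyOfFiniteType.isLocallyNoetherian π
  exact ⟨fun h ↦ DiffCI.IsLCIAt.isDCIAt h, fun h ↦ DiffCI.IsDCIAt.isLCIAt h⟩
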